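/- Let $n\ge 2$, let $Y:=(0,1)^n\subset\mathbb{R}^n$, and let $\mathcal{A},\mathcal{B}$ be nonempty compact metric spaces. Let $$A:\mathbb{R}^n\times\mathcal{A}\times\mathcal{B}\to\mathbb{R}^{n\times n}_{\mathrm{sym}},\qquad b:\mathbb{R}^n\times\mathcal{A}\times\mathcal{B}\to\mathbb{R}^n,\qquad c,f:\mathbb{R}^n\times\mathcal{A}\times\mathcal{B}\to\mathbb{R}$$ be uniformly continuous and $Y$-periodic in their first argument, that is, invariant under translating it by any standard unit vector; write $\varphi^{\alpha\beta}:=\varphi(\cdot,\alpha,\beta)$ for $\varphi\in\{A,b,c,f\}$. Assume that $\inf_{\mathbb{R}^n\times\mathcal{A}\times\mathcal{B}}c>0$, that $A$ is uniformly elliptic, i.e. there are $\zeta_1,\zeta_2>0$ with $$\zeta_1|\xi|^2\le A(y,\alpha,\beta)\xi\cdot\xi\le\zeta_2|\xi|^2\qquad\text{for all }y,\xi\in\mathbb{R}^n,\ (\alpha,\beta)\in\mathcal{A}\times\mathcal{B},$$ and that the Cordes condition holds: there are $\delta\in(0,1)$ and $\lambda>0$ such that $$|A|^2+\frac{|b|^2}{2\lambda}+\frac{c^2}{\lambda^2}\le\frac{1}{n+\delta}\Big(\operatorname{tr}(A)+\frac{c}{\lambda}\Big)^2\qquad\text{in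 }\mathbb{R}^n\times\mathcal{A}\times\mathcal{B},$$ where $M:N:=\sum_{i,j}M_{ij}N_{ij}$ and $|M|:=\sqrt{M:M}$. Let $H^2_{\mathrm{per}}(Y)\subset H^2(Y)$ be the closure, with respect to the $H^2(Y)$-norm, of the set of restrictions to $Y$ of smooth $Y$-periodic functions $v:\mathbb{R}^n\to\mathbb{R}$. Then there exists a unique function $u\in H^2_{\mathrm{per}}(Y)$ (functions equal almost everywhere being identified) such that $$\inf_{\alpha\in\mathcal{A}}\sup_{\beta\in\mathcal{B}}\left\{-A^{\alpha\beta}:\nabla^2u-b^{\alpha\beta}\cdot\nabla u+c^{\alpha\beta}u-f^{\alpha\beta}\right\}=0\qquad\text{almost everywhere in }Y,$$ where $\nabla u$ and $\nabla^2u$ denote the weak gradient and the weak Hessian of $u$. -/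

import Mathlib

open MeasureTheory Set
open scoped ContDiff Matrix

noncomputable section

namespace HJBI

/-- `ℝⁿ` with its Euclidean structure. -/
abbrev Space (n : ℕ) : Type := EuclideanSpace ℝ (Fin n)

/-- The standard unit vector `eᵢ`. -/
abbrev basisVec {n : ℕ} (i : Fin n) : Space n := EuclideanSpace.single i (1 : ℝ)

/-- The open unit cell `Y = (0,1)ⁿ`. -/
def unitCell (n : ℕ) : Set (Space n) := {y | ∀ i, y i ∈ Ioo (0 : ℝ) 1}

/-- Lebesgue measure on `Y`. -/
abbrev cellMeasure (n : ℕ) : Measure (Space n) := volume.restrict (unitCell n)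

/-- `Y`-periodicity of a function on `ℝⁿ`: invariance under translation by each unit vector. -/
def YPeriodic {n : ℕ} {R : Type*} (g : Space n → R) : Prop :=
  ∀ (i : Fin n) (y : Space n), g (y + basisVec i) = g y

/-! ### Sobolev spaces on the unit cell -/

/-- `L²(Y)`. -/
abbrev L2Y (n : ℕ) : Type := Lp ℝ 2 (cellMeasure n)

/-- Test functions `C_c^∞(Y)`. -/
def IsTestFunction {n : ℕ} (φ : Space n → ℝ) : Prop :=
  ContDiff ℝ ∞ φ ∧ HasCompactSupport φ ∧ tsupport φ ⊆ unitCell n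

/-- `g ∈ L²(Y)` is the weak partial derivative `∂ᵢ u` of `u ∈ L²(Y)` in `Y`. -/
def IsWeakPartial {n : ℕ} (i : Fin n) (u g : L2Y n) : Prop :=
  ∀ φ : Space n → ℝ, IsTestFunction φ →
    ∫ y in unitCell n, u y * fderiv ℝ φ y (basisVec i) = -∫ y in unitCell n, g y * φ y

open Classical in
/-- The weak partial derivative `∂ᵢ u ∈ L²(Y)` (zero if `u` has none in `L²(Y)`). -/
def weakPartial {n : ℕ} (i : Fin n) (u : L2Y n) : L2Y n :=
  if h : ∃ g : L2Y n, IsWeakPartial i u g then h.choose else 0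

/-- The weak second derivative `∂ⱼ ∂ᵢ u`. -/
def weakPartial₂ {n : ℕ} (i j : Fin n) (u : L2Y n) : L2Y n :=
  weakPartial j (weakPartial i u)

/-- The Sobolev space `H²(Y)`: all weak derivatives up to order two exist in `L²(Y)`. -/
def H2 (n : ℕ) : Set (L2Y n) :=
  {u | (∀ i, ∃ g, IsWeakPartial i u g) ∧ ∀ i j, ∃ g, IsWeakPartial j (weakPartial i u) g}

/-- The `H²(Y)`-norm (meaningful on `H²(Y)`). -/
def h2Norm {n : ℕ} (u : L2Y n) : ℝ :=
  Real.sqrt (‖u‖ ^ 2 + (∑ i, ‖weakPartial i u‖ ^ 2) + ∑ i, ∑ j, ‖weakPartial₂ i j u‖ ^ 2)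

/-- `C^∞_per(Y)`: restrictions to `Y` of smooth `Y`-periodic functions on `ℝⁿ`,
as elements of `L²(Y)`. -/
def smoothPeriodic (n : ℕ) : Set (L2Y n) :=
  {w | ∃ v : Space n → ℝ, ContDiff ℝ ∞ v ∧ YPeriodic v ∧ w =ᵐ[cellMeasure n] v}

/-- `H²_per(Y)`: the closure of `C^∞_per(Y)` in `H²(Y)` with respect to the `H²(Y)`-norm. -/
def H2per (n : ℕ) : Set (L2Y n) :=
  {u | u ∈ H2 n ∧ ∀ ε : ℝ, 0 < ε → ∃ w ∈ smoothPeriodic n, h2Norm (u - w) < ε}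

/-- The weak gradient `∇u(y)`. -/
def weakGrad {n : ℕ} (u : L2Y n) (y : Space n) : Space n :=
  WithLp.toLp 2 fun i => weakPartial i u y

/-- The weak Hessian `∇²u(y)`. -/
def weakHess {n : ℕ} (u : L2Y n) (y : Space n) : Matrix (Fin n) (Fin n) ℝ :=
  Matrix.of fun i j => weakPartial₂ i j u y

/-! ### The HJBI operator and the conditions on its coefficients -/

/-- The Frobenius product `M : N = ∑ᵢⱼ Mᵢⱼ Nᵢⱼ`; the Frobenius norm is `|M|² = M : M`. -/
def frob {n : ℕ} (M N : Matrix (Fin n) (Fin n) ℝ) : ℝ := ∑ i, ∑ j, M i j * N i j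

variable {n : ℕ} {𝒜 ℬ : Type*}

/-- `F[u](y) = inf_α sup_β (-A : ∇²u - b · ∇u + c u - f)(y)`. -/
def hjbiOp (A : Space n × 𝒜 × ℬ → Matrix (Fin n) (Fin n) ℝ) (b : Space n × 𝒜 × ℬ → Space n)
    (c f : Space n × 𝒜 × ℬ → ℝ) (u : L2Y n) (y : Space n) : ℝ :=
  ⨅ α : 𝒜, ⨆ β : ℬ,
    (-frob (A (y, α, β)) (weakHess u y) - inner ℝ (b (y, α, β)) (weakGrad u y)
      + c (y, α, β) * u y - f (y, α, β))

/-- `u ∈ H²_per(Y)` is a periodic strong solution if `F[u] = 0` almost everywhere in `Y`. -/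
def IsPeriodicStrongSolution (A : Space n × 𝒜 × ℬ → Matrix (Fin n) (Fin n) ℝ)
    (b : Space n × 𝒜 × ℬ → Space n) (c f : Space n × 𝒜 × ℬ → ℝ) (u : L2Y n) : Prop :=
  u ∈ H2per n ∧ ∀ᵐ y ∂(cellMeasure n), hjbiOp A b c f u y = 0

/-- Uniform ellipticity. -/
def UniformlyElliptic (A : Space n × 𝒜 × ℬ → Matrix (Fin n) (Fin n) ℝ) : Prop :=
  ∃ ζ₁ ζ₂ : ℝ, 0 < ζ₁ ∧ 0 < ζ₂ ∧ ∀ (p : Space n × 𝒜 × ℬ) (ξ : Space n),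
    ζ₁ * ‖ξ‖ ^ 2 ≤ (A p *ᵥ ξ.ofLp) ⬝ᵥ ξ.ofLp ∧ (A p *ᵥ ξ.ofLp) ⬝ᵥ ξ.ofLp ≤ ζ₂ * ‖ξ‖ ^ 2

/-- The Cordes condition, for some `δ ∈ (0,1)` and `lam > 0`. -/
def CordesCondition (A : Space n × 𝒜 × ℬ → Matrix (Fin n) (Fin n) ℝ)
    (b : Space n × 𝒜 × ℬ → Space n) (c : Space n × 𝒜 × ℬ → ℝ) : Prop :=
  ∃ δ lam : ℝ, 0 < δ ∧ δ < 1 ∧ 0 < lam ∧ ∀ p : Space n × 𝒜 × ℬ,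
    frob (A p) (A p) + ‖b p‖ ^ 2 / (2 * lam) + c p ^ 2 / lam ^ 2
      ≤ 1 / ((n : ℝ) + δ) * ((A p).trace + c p / lam) ^ 2

end HJBI

end

open MeasureTheory Set
open scoped ContDiff Matrix

noncomputable section

namespace HJBI

variable {n : ℕ}

/-! ### The unit cell -/

/-! The Cordes condition makes the nonlinear operator a small perturbation of `λ - Δ`. Put `γ = (tr
A + c/λ) / (|A|² + |b|²/(2λ) + c²/λ²)`. The condition says exactly that `(γA, γb, γc)` lies at
squared distance at most `1 - δ` from the coefficients `(I, 0, λ)` of `λ - Δ`, in the norm dual to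
the jet norm `|M|² + 2λ|ξ|² + λ²r²` (`cordes_estimate`).

As `γ > 0` and the parameter sets are compact, the equation only constrains signs, so `γ` may be
inserted under the inf-sup without changing the solutions (`iInf_iSup_mul_eq_zero_iff`). Inf-sup
preserves uniform closeness, so the renormalised operator `Φ` satisfies, almost everywhere, that
`|Φ[u] - Φ[v] - (λ - Δ)(u - v)|²` is at most `1 - δ` times the squared jet norm of `u - v`
(`scaledOp_sub_sq_le`).

For periodic functions, integration by parts leaves no boundary terms and gives `‖λu - Δu‖² = ‖∇²u‖²
+ 2λ‖∇u‖² + λ²‖u‖²` (`energy_identity`). The right side is the integral of the same squared jet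
norm, so no constant is lost: `‖Φ[u] - Φ[v] - (λ - Δ)(u - v)‖ ≤ √(1 - δ) ‖(λ - Δ)(u - v)‖`.

Finally `λ - Δ` is a bijection from `H²_per(Y)` onto `L²(Y)`: the energy identity gives injectivity
and closed range, and the trigonometric modes, being eigenfunctions with positive eigenvalues, give
dense range (`exists_resolventOp_eq`). With `S` its inverse, `g ↦ g - Φ(S g)` is a contraction of
`L²(Y)`, and Banach's theorem concludes. -/

theorem unitCell_eq_preimage :
    unitCell n = WithLp.ofLp ⁻¹' (univ.pi fun _ : Fin n => Ioo (0 : ℝ) 1) := by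
  ext y; simp [unitCell]

theorem isOpen_unitCell : IsOpen (unitCell n) := by
  rw [unitCell_eq_preimage]
  exact (isOpen_set_pi finite_univ fun _ _ => isOpen_Ioo).preimage (PiLp.continuous_ofLp 2 _)

/-- The closed unit cell `[0,1]ⁿ`. -/
def closedCell (n : ℕ) : Set (Space n) := WithLp.toLp 2 '' Icc 0 1

theorem isCompact_closedCell : IsCompact (closedCell n) :=
  isCompact_Icc.image (PiLp.continuous_toLp 2 _)

theorem unitCell_subset_closedCell : unitCell n ⊆ closedCell n := fun y hy =>
  ⟨y.ofLp, ⟨fun i => (hy i).1.le, fun i => (hy i).2.le⟩, rfl⟩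

instance : IsFiniteMeasure (cellMeasure n) :=
  ⟨by
    rw [Measure.restrict_apply_univ]
    exact (measure_mono unitCell_subset_closedCell).trans_lt isCompact_closedCell.measure_lt_top⟩

theorem ae_mem_unitCell : ∀ᵐ y ∂(cellMeasure n), y ∈ unitCell n :=
  ae_restrict_mem isOpen_unitCell.measurableSet

theorem memLp_of_continuous {v : Space n → ℝ} (hv : Continuous v) : MemLp v 2 (cellMeasure n) := by
  obtain ⟨C, hC⟩ := isCompact_closedCell.exists_bound_of_continuousOn hv.continuousOn
  refine MemLp.of_bound hv.aestronglyMeasurable C ?_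
  filter_upwards [ae_mem_unitCell] with y hy using hC y (unitCell_subset_closedCell hy)

/-- The class in `L²(Y)` of a continuous function. -/
def cellClass (v : Space n → ℝ) (hv : Continuous v) : L2Y n := (memLp_of_continuous hv).toLp v

theorem coeFn_cellClass {v : Space n → ℝ} (hv : Continuous v) :
    cellClass v hv =ᵐ[cellMeasure n] v := MemLp.coeFn_toLp _

theorem inner_cellClass {v : Space n → ℝ} (hv : Continuous v) (u : L2Y n) :
    inner ℝ (cellClass v hv) u = ∫ y in unitCell n, u y * v y := by
  rw [L2.inner_def]
  refine integral_congr_ae ?_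
  filter_upwards [coeFn_cellClass hv] with y hy
  simp [hy]

theorem integral_cellClass_mul {v w : Space n → ℝ} (hv : Continuous v) :
    ∫ y in unitCell n, cellClass v hv y * w y = ∫ y in unitCell n, v y * w y := by
  refine integral_congr_ae ?_
  filter_upwards [coeFn_cellClass hv] with y hy
  rw [hy]

/-! ### Classical partial derivatives -/

/-- The classical partial derivative `∂ᵢ v`. -/
def pd (i : Fin n) (v : Space n → ℝ) (y : Space n) : ℝ := fderiv ℝ v y (basisVec i)

theorem contDiff_pd {v : Space n → ℝ} (hv : ContDiff ℝ ∞ v) (i : Fin n) :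
    ContDiff ℝ ∞ (pd i v) :=
  (hv.fderiv_right (m := ∞) (by simp)).clm_apply contDiff_const

theorem YPeriodic.pd {v : Space n → ℝ} (hv : YPeriodic v) (i : Fin n) : YPeriodic (pd i v) := by
  intro j y
  have : (fun z => v (z + basisVec j)) = v := funext (hv j)
  simp only [HJBI.pd]
  rw [← fderiv_comp_add_right (f := v), this]

theorem pd_mul {v w : Space n → ℝ} (hv : ContDiff ℝ ∞ v) (hw : ContDiff ℝ ∞ w) (i : Fin n)
    (y : Space n) : pd i (fun z => v z * w z) y = v y * pd i w y + pd i v y * w y := by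
  have h1 := (hv.differentiable (by simp)) y
  have h2 := (hw.differentiable (by simp)) y
  simp only [pd]
  rw [fderiv_fun_mul h1 h2]
  simp [mul_comm]

theorem pd_comm {v : Space n → ℝ} (hv : ContDiff ℝ ∞ v) (i j : Fin n) (y : Space n) :
    pd i (pd j v) y = pd j (pd i v) y := by
  have hd : DifferentiableAt ℝ (fderiv ℝ v) y :=
    (hv.fderiv_right (m := ∞) (by simp)).differentiable (by simp) y
  have hs : IsSymmSndFDerivAt ℝ v y := hv.contDiffAt.isSymmSndFDerivAt
    (by simpa using WithTop.coe_le_coe.2 (le_top : (2 : ℕ∞) ≤ ⊤))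
  have key (a b : Fin n) : pd a (pd b v) y = fderiv ℝ (fderiv ℝ v) y (basisVec a) (basisVec b) := by
    simp only [pd]
    change fderiv ℝ (fun z => fderiv ℝ v z (basisVec b)) y (basisVec a) = _
    rw [fderiv_clm_apply hd (by fun_prop)]
    simp
  rw [key, key, hs.eq]

/-! ### Weak partial derivatives -/

theorem IsTestFunction.continuous {φ : Space n → ℝ} (h : IsTestFunction φ) : Continuous φ :=
  h.1.continuous

theorem IsTestFunction.continuous_pd {φ : Space n → ℝ} (h : IsTestFunction φ) (i : Fin n) :
    Continuous (pd i φ) := (contDiff_pd h.1 i).continuous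

/-- In this form the defining identity is visibly linear and continuous in `(u, g)`, which yields
linearity and closedness of weak differentiation. -/
theorem isWeakPartial_iff {i : Fin n} {u g : L2Y n} :
    IsWeakPartial i u g ↔ ∀ φ (hφ : IsTestFunction φ),
      inner ℝ (cellClass _ (hφ.continuous_pd i)) u = -inner ℝ (cellClass φ hφ.continuous) g := by
  simp only [inner_cellClass]
  rfl

/-- The fundamental lemma of the calculus of variations; it frees `weakPartial` from the arbitrary
choice in its definition. -/
theorem IsWeakPartial.unique {i : Fin n} {u g h : L2Y n} (hg : IsWeakPartial i u g)
    (hh : IsWeakPartial i u h) : g = h := by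
  rw [← sub_eq_zero]
  rw [isWeakPartial_iff] at hg hh
  have hloc : LocallyIntegrableOn (g - h : L2Y n) (unitCell n) := by
    have : Integrable (g - h : L2Y n) (cellMeasure n) := (Lp.memLp _).integrable one_le_two
    exact IntegrableOn.locallyIntegrableOn this
  have := isOpen_unitCell.ae_eq_zero_of_integral_contDiff_smul_eq_zero hloc fun φ h1 h2 h3 => by
    have hφ : IsTestFunction φ := ⟨h1, h2, h3⟩
    have e : inner ℝ (cellClass φ hφ.continuous) (g - h) = 0 := by
      rw [inner_sub_right, sub_eq_zero, ← neg_inj, ← hg φ hφ, ← hh φ hφ]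
    rw [inner_cellClass, setIntegral_eq_integral_of_forall_compl_eq_zero] at e
    · simpa [mul_comm] using e
    · intro y hy
      have : φ y = 0 := image_eq_zero_of_notMem_tsupport fun hy' => hy (h3 hy')
      simp [this]
  rw [Lp.eq_zero_iff_ae_eq_zero]
  exact (ae_restrict_iff' isOpen_unitCell.measurableSet).2 this

theorem IsWeakPartial.weakPartial_eq {i : Fin n} {u g : L2Y n} (h : IsWeakPartial i u g) :
    weakPartial i u = g := by
  have hex : ∃ g, IsWeakPartial i u g := ⟨g, h⟩
  rw [weakPartial, dif_pos hex]
  exact hex.choose_spec.unique h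

theorem isWeakPartial_weakPartial {i : Fin n} {u : L2Y n} (h : ∃ g, IsWeakPartial i u g) :
    IsWeakPartial i u (weakPartial i u) := by
  obtain ⟨g, hg⟩ := h
  rwa [hg.weakPartial_eq]

theorem IsWeakPartial.add {i : Fin n} {u v g h : L2Y n} (hu : IsWeakPartial i u g)
    (hv : IsWeakPartial i v h) : IsWeakPartial i (u + v) (g + h) := by
  rw [isWeakPartial_iff] at *
  intro φ hφ
  rw [inner_add_right, inner_add_right, hu φ hφ, hv φ hφ]
  ring

theorem IsWeakPartial.smul {i : Fin n} {u g : L2Y n} (hu : IsWeakPartial i u g) (r : ℝ) :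
    IsWeakPartial i (r • u) (r • g) := by
  rw [isWeakPartial_iff] at *
  intro φ hφ
  rw [inner_smul_right, inner_smul_right, hu φ hφ]
  ring

/-- For a fixed test function both sides of the identity are continuous on `L²(Y)`, so weak
differentiation is a closed operator. -/
theorem IsWeakPartial.of_tendsto {i : Fin n} {u g : ℕ → L2Y n} {u' g' : L2Y n}
    (h : ∀ m, IsWeakPartial i (u m) (g m)) (hu : Filter.Tendsto u Filter.atTop (nhds u'))
    (hg : Filter.Tendsto g Filter.atTop (nhds g')) : IsWeakPartial i u' g' := by
  simp only [isWeakPartial_iff] at *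
  intro φ hφ
  refine tendsto_nhds_unique (tendsto_const_nhds.inner hu) ?_
  simp only [h _ φ hφ]
  exact (tendsto_const_nhds.inner hg).neg

/-- The test function vanishes off the cell, so the integrals extend to the whole space, where
integration by parts has no boundary term. -/
theorem isWeakPartial_cellClass {v : Space n → ℝ} (hv : ContDiff ℝ ∞ v) (i : Fin n) :
    IsWeakPartial i (cellClass v hv.continuous)
      (cellClass (pd i v) (contDiff_pd hv i).continuous) := by
  intro φ hφ
  rw [integral_cellClass_mul, integral_cellClass_mul]
  have hsupp {y : Space n} (hy : y ∉ unitCell n) : y ∉ tsupport φ := fun h => hy (hφ.2.2 h)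
  rw [setIntegral_eq_integral_of_forall_compl_eq_zero,
    setIntegral_eq_integral_of_forall_compl_eq_zero]
  · have hc := hφ.2.1
    refine integral_mul_fderiv_eq_neg_fderiv_mul_of_integrable ?_ ?_ ?_
      (fun y _ => hv.differentiable (by simp) y) (fun y _ => hφ.1.differentiable (by simp) y)
    · exact ((contDiff_pd hv i).continuous.mul hφ.continuous).integrable_of_hasCompactSupport
        hc.mul_left
    · exact (hv.continuous.mul (hφ.continuous_pd i)).integrable_of_hasCompactSupport
        (hc.fderiv_apply (𝕜 := ℝ) (basisVec i)).mul_left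
    · exact (hv.continuous.mul hφ.continuous).integrable_of_hasCompactSupport hc.mul_left
  · intro y hy
    rw [image_eq_zero_of_notMem_tsupport (hsupp hy), mul_zero]
  · intro y hy
    have : fderiv ℝ φ y = 0 := by
      refine image_eq_zero_of_notMem_tsupport fun h => hsupp hy (tsupport_fderiv_subset ℝ h)
    simp [this]

/-! ### The space `H²(Y)` -/

/-- `u`, `p`, `q` are the components of a weak `2`-jet. -/
structure IsWeakJet (u : L2Y n) (p : Fin n → L2Y n) (q : Fin n → Fin n → L2Y n) : Prop where
  grad : ∀ i, IsWeakPartial i u (p i)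
  hess : ∀ i j, IsWeakPartial j (p i) (q i j)

section Jet

variable {u v : L2Y n} {p p' : Fin n → L2Y n} {q q' : Fin n → Fin n → L2Y n}

theorem IsWeakJet.weakPartial_eq (h : IsWeakJet u p q) (i : Fin n) : weakPartial i u = p i :=
  (h.grad i).weakPartial_eq

theorem IsWeakJet.weakPartial₂_eq (h : IsWeakJet u p q) (i j : Fin n) :
    weakPartial₂ i j u = q i j := by
  rw [weakPartial₂, h.weakPartial_eq, (h.hess i j).weakPartial_eq]

theorem IsWeakJet.mem_H2 (h : IsWeakJet u p q) : u ∈ H2 n :=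
  ⟨fun i => ⟨_, h.grad i⟩, fun i j => ⟨q i j, by rw [h.weakPartial_eq]; exact h.hess i j⟩⟩

theorem isWeakJet_of_mem_H2 (h : u ∈ H2 n) :
    IsWeakJet u (fun i => weakPartial i u) fun i j => weakPartial₂ i j u :=
  ⟨fun i => isWeakPartial_weakPartial (h.1 i), fun i j => isWeakPartial_weakPartial (h.2 i j)⟩

theorem IsWeakJet.add (h : IsWeakJet u p q) (h' : IsWeakJet v p' q') :
    IsWeakJet (u + v) (p + p') (q + q') :=
  ⟨fun i => (h.grad i).add (h'.grad i), fun i j => (h.hess i j).add (h'.hess i j)⟩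

theorem IsWeakJet.smul (h : IsWeakJet u p q) (r : ℝ) : IsWeakJet (r • u) (r • p) (r • q) :=
  ⟨fun i => (h.grad i).smul r, fun i j => (h.hess i j).smul r⟩

theorem IsWeakJet.sub (h : IsWeakJet u p q) (h' : IsWeakJet v p' q') :
    IsWeakJet (u - v) (p - p') (q - q') := by
  simpa [sub_eq_add_neg] using h.add (h'.smul (-1))

theorem weakPartial_sub (hu : u ∈ H2 n) (hv : v ∈ H2 n) (i : Fin n) :
    weakPartial i (u - v) = weakPartial i u - weakPartial i v :=
  ((isWeakJet_of_mem_H2 hu).sub (isWeakJet_of_mem_H2 hv)).weakPartial_eq i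

theorem weakPartial₂_sub (hu : u ∈ H2 n) (hv : v ∈ H2 n) (i j : Fin n) :
    weakPartial₂ i j (u - v) = weakPartial₂ i j u - weakPartial₂ i j v :=
  ((isWeakJet_of_mem_H2 hu).sub (isWeakJet_of_mem_H2 hv)).weakPartial₂_eq i j

end Jet

theorem isWeakJet_cellClass {v : Space n → ℝ} (hv : ContDiff ℝ ∞ v) :
    IsWeakJet (cellClass v hv.continuous)
      (fun i => cellClass (pd i v) (contDiff_pd hv i).continuous)
      (fun i j => cellClass (pd j (pd i v)) (contDiff_pd (contDiff_pd hv i) j).continuous) :=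
  ⟨fun i => isWeakPartial_cellClass hv i, fun i j => isWeakPartial_cellClass (contDiff_pd hv i) j⟩

theorem mem_smoothPeriodic_iff {w : L2Y n} : w ∈ smoothPeriodic n ↔
    ∃ (v : Space n → ℝ) (hv : ContDiff ℝ ∞ v), YPeriodic v ∧ w = cellClass v hv.continuous := by
  constructor
  · rintro ⟨v, hv, hp, h⟩
    exact ⟨v, hv, hp, Lp.ext (h.trans (coeFn_cellClass _).symm)⟩
  · rintro ⟨v, hv, hp, rfl⟩
    exact ⟨v, hv, hp, coeFn_cellClass _⟩

theorem smoothPeriodic_subset_H2 : smoothPeriodic n ⊆ H2 n := by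
  intro w hw
  obtain ⟨v, hv, -, rfl⟩ := mem_smoothPeriodic_iff.1 hw
  exact (isWeakJet_cellClass hv).mem_H2

theorem add_mem_smoothPeriodic {w w' : L2Y n} (h : w ∈ smoothPeriodic n)
    (h' : w' ∈ smoothPeriodic n) : w + w' ∈ smoothPeriodic n := by
  obtain ⟨v, hv, hp, e⟩ := h
  obtain ⟨v', hv', hp', e'⟩ := h'
  refine ⟨v + v', hv.add hv', fun i y => by simp [hp i y, hp' i y], ?_⟩
  exact (Lp.coeFn_add _ _).trans (e.add e')

theorem smul_mem_smoothPeriodic {w : L2Y n} (r : ℝ) (h : w ∈ smoothPeriodic n) :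
    r • w ∈ smoothPeriodic n := by
  obtain ⟨v, hv, hp, e⟩ := h
  refine ⟨r • v, contDiff_const.smul hv, fun i y => by simp [hp i y], ?_⟩
  exact (Lp.coeFn_smul _ _).trans (e.const_smul r)

theorem sub_mem_smoothPeriodic {w w' : L2Y n} (h : w ∈ smoothPeriodic n)
    (h' : w' ∈ smoothPeriodic n) : w - w' ∈ smoothPeriodic n := by
  simpa [sub_eq_add_neg] using add_mem_smoothPeriodic h (smul_mem_smoothPeriodic (-1) h')

/-! ### Integration by parts over a period -/

theorem setIntegral_unitCell (h : Space n → ℝ) :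
    ∫ y in unitCell n, h y = ∫ x in Icc (0 : Fin n → ℝ) 1, h (WithLp.toLp 2 x) := by
  have hae : univ.pi (fun _ : Fin n => Ioo (0 : ℝ) 1) =ᵐ[volume] Icc (0 : Fin n → ℝ) 1 :=
    Measure.univ_pi_Ioo_ae_eq_Icc
  rw [← setIntegral_congr_set hae, unitCell_eq_preimage]
  exact (PiLp.volume_preserving_ofLp (Fin n)).setIntegral_preimage_emb
    (MeasurableEquiv.toLp 2 (Fin n → ℝ)).symm.measurableEmbedding
    (fun x => h (WithLp.toLp 2 x)) _

/-- The divergence theorem on the cube: periodicity makes the contributions of opposite faces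
cancel. -/
theorem integral_pd_eq_zero {F : Space n → ℝ} (hF : ContDiff ℝ ∞ F) (hp : YPeriodic F)
    (i : Fin n) : ∫ y in unitCell n, pd i F y = 0 := by
  obtain _ | m := n
  · exact i.elim0
  rw [setIntegral_unitCell]
  let e : (Fin (m + 1) → ℝ) →L[ℝ] Space (m + 1) :=
    ((PiLp.continuousLinearEquiv 2 ℝ fun _ : Fin (m + 1) => ℝ).symm : _ →L[ℝ] _)
  have he (x) : e x = WithLp.toLp 2 x := rfl
  -- The vector field `F eᵢ`, whose divergence is `∂ᵢF`.
  let f : Fin (m + 1) → (Fin (m + 1) → ℝ) → ℝ := fun j x => if j = i then F (e x) else 0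
  let f' : Fin (m + 1) → (Fin (m + 1) → ℝ) → (Fin (m + 1) → ℝ) →L[ℝ] ℝ :=
    fun j x => if j = i then (fderiv ℝ F (e x)).comp e else 0
  have hsum (x) : ∑ j, f' j x (Pi.single j 1) = pd i F (WithLp.toLp 2 x) := by
    rw [Finset.sum_eq_single i]
    · simp [f', pd, he]
    · intro j _ hj
      simp [f', hj]
    · simp
  have hcont : Continuous fun x : Fin (m + 1) → ℝ => pd i F (WithLp.toLp 2 x) :=
    (contDiff_pd hF i).continuous.comp (PiLp.continuous_toLp 2 _)
  have key := integral_divergence_of_hasFDerivAt_off_countable' (0 : Fin (m + 1) → ℝ) 1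
    zero_le_one f f' ∅ countable_empty (fun j => ?_) (fun x _ j => ?_) ?_
  · simp only [hsum] at key
    rw [key]
    refine Finset.sum_eq_zero fun j _ => ?_
    by_cases hj : j = i
    · subst hj
      rw [sub_eq_zero]
      congr 1
      ext x
      simp only [f, if_true]
      -- A point of the face `xⱼ = 1` is its counterpart on `xⱼ = 0` translated by `eⱼ`.
      refine Eq.trans ?_ (hp j (e _))
      congr 1
      ext k
      induction k using Fin.succAboveCases j <;> simp [he]
    · simp [f, hj]
  · by_cases hj : j = i
    · simp only [f, hj, if_true]
      exact (hF.continuous.comp e.continuous).continuousOn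
    · simp only [f, hj, if_false]
      exact continuousOn_const
  · by_cases hj : j = i
    · simp only [f, f', hj, if_true]
      exact ((hF.differentiable (by simp)) (e x)).hasFDerivAt.comp x e.hasFDerivAt
    · simp only [f, f', hj, if_false]
      exact hasFDerivAt_const _ _
  · simp only [hsum]
    exact hcont.continuousOn.integrableOn_compact isCompact_Icc

theorem inner_cellClass_cellClass {v w : Space n → ℝ} (hv : Continuous v) (hw : Continuous w) :
    inner ℝ (cellClass v hv) (cellClass w hw) = ∫ y in unitCell n, v y * w y := by
  rw [inner_cellClass, integral_cellClass_mul]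
  simp only [mul_comm]

theorem integrableOn_unitCell {v : Space n → ℝ} (hv : Continuous v) :
    IntegrableOn v (unitCell n) :=
  (memLp_of_continuous hv).integrable one_le_two

/-- Integration by parts for smooth periodic functions. -/
theorem inner_pd_right {v w : Space n → ℝ} (hv : ContDiff ℝ ∞ v) (hw : ContDiff ℝ ∞ w)
    (hpv : YPeriodic v) (hpw : YPeriodic w) (i : Fin n) :
    inner ℝ (cellClass v hv.continuous) (cellClass (pd i w) (contDiff_pd hw i).continuous) =
      -inner ℝ (cellClass (pd i v) (contDiff_pd hv i).continuous) (cellClass w hw.continuous) := by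
  have h := integral_pd_eq_zero (hv.mul hw) (fun j y => by simp only [hpv j y, hpw j y]) i
  simp only [pd_mul hv hw] at h
  erw [integral_add (integrableOn_unitCell (hv.continuous.mul (contDiff_pd hw i).continuous))
    (integrableOn_unitCell ((contDiff_pd hv i).continuous.mul hw.continuous))] at h
  rw [inner_cellClass_cellClass, inner_cellClass_cellClass]
  exact eq_neg_of_add_eq_zero_left h

/-! ### The operator `lam - Δ` -/

/-- The operator `lam u - Δ u`. -/
def resolventOp (lam : ℝ) (u : L2Y n) : L2Y n := lam • u - ∑ i, weakPartial₂ i i u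

/-- The square of the `lam`-weighted `H²`-norm. -/
def energy (lam : ℝ) (u : L2Y n) : ℝ :=
  (∑ i, ∑ j, ‖weakPartial₂ i j u‖ ^ 2) + 2 * lam * (∑ i, ‖weakPartial i u‖ ^ 2)
    + lam ^ 2 * ‖u‖ ^ 2

theorem IsWeakJet.resolventOp_eq {u : L2Y n} {p : Fin n → L2Y n} {q : Fin n → Fin n → L2Y n}
    (h : IsWeakJet u p q) (lam : ℝ) : resolventOp lam u = lam • u - ∑ i, q i i := by
  simp only [resolventOp, h.weakPartial₂_eq]

theorem IsWeakJet.energy_eq {u : L2Y n} {p : Fin n → L2Y n} {q : Fin n → Fin n → L2Y n}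
    (h : IsWeakJet u p q) (lam : ℝ) : energy lam u =
      (∑ i, ∑ j, ‖q i j‖ ^ 2) + 2 * lam * (∑ i, ‖p i‖ ^ 2) + lam ^ 2 * ‖u‖ ^ 2 := by
  simp only [energy, h.weakPartial₂_eq, h.weakPartial_eq]

theorem resolventOp_sub (lam : ℝ) {u v : L2Y n} (hu : u ∈ H2 n) (hv : v ∈ H2 n) :
    resolventOp lam (u - v) = resolventOp lam u - resolventOp lam v := by
  simp only [resolventOp, weakPartial₂_sub hu hv, Finset.sum_sub_distrib, smul_sub]
  abel

/-- The Hilbert space algebra behind the energy identity: `hp` turns the cross term into the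
gradient term, and `hq` turns the square of the Laplacian into that of the Hessian. -/
theorem norm_sq_smul_sub_sum {E ι : Type*} [NormedAddCommGroup E] [InnerProductSpace ℝ E]
    [Fintype ι] (lam : ℝ) (u : E) (p : ι → E) (q : ι → ι → E)
    (hp : ∀ i, inner ℝ u (q i i) = -inner ℝ (p i) (p i))
    (hq : ∀ i j, inner ℝ (q i i) (q j j) = inner ℝ (q i j) (q i j)) :
    ‖lam • u - ∑ i, q i i‖ ^ 2 =
      (∑ i, ∑ j, ‖q i j‖ ^ 2) + 2 * lam * (∑ i, ‖p i‖ ^ 2) + lam ^ 2 * ‖u‖ ^ 2 := by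
  rw [norm_sub_sq_real, inner_sum]
  simp only [inner_smul_left, hp]
  rw [← real_inner_self_eq_norm_sq (∑ i, q i i)]
  simp only [sum_inner, inner_sum, hq, real_inner_self_eq_norm_sq, norm_smul, mul_pow,
    Real.norm_eq_abs, sq_abs]
  rw [Finset.sum_comm]
  simp only [RCLike.conj_to_real, mul_neg, Finset.sum_neg_distrib, ← Finset.mul_sum]
  ring_nf

theorem cellClass_congr {f g : Space n → ℝ} (hf : Continuous f) (hg : Continuous g)
    (h : ∀ y, f y = g y) : cellClass f hf = cellClass g hg := by
  obtain rfl : f = g := funext h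
  rfl

/-- Two integrations by parts through third derivatives: `⟨∂ᵢᵢv, ∂ⱼⱼv⟩ = -⟨∂ᵢv, ∂ᵢ∂ⱼⱼv⟩ = -⟨∂ᵢv,
∂ⱼ∂ᵢ∂ⱼv⟩ = ⟨∂ⱼ∂ᵢv, ∂ᵢ∂ⱼv⟩`. -/
theorem inner_pd_pd {v : Space n → ℝ} (hv : ContDiff ℝ ∞ v) (hp : YPeriodic v) (i j : Fin n) :
    inner ℝ (cellClass (pd i (pd i v)) (contDiff_pd (contDiff_pd hv i) i).continuous)
        (cellClass (pd j (pd j v)) (contDiff_pd (contDiff_pd hv j) j).continuous) =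
      inner ℝ (cellClass (pd j (pd i v)) (contDiff_pd (contDiff_pd hv i) j).continuous)
        (cellClass (pd j (pd i v)) (contDiff_pd (contDiff_pd hv i) j).continuous) := by
  have c1 (i) := contDiff_pd hv i
  have c2 (i j) := contDiff_pd (c1 j) i
  have p1 (i) := hp.pd i
  have p2 (i j) := (p1 j).pd i
  have e1 : cellClass (pd i (pd j (pd j v))) (contDiff_pd (c2 j j) i).continuous =
      cellClass (pd j (pd i (pd j v))) (contDiff_pd (c2 i j) j).continuous :=
    cellClass_congr _ _ (pd_comm (c1 j) i j)
  have e2 : cellClass (pd i (pd j v)) (c2 i j).continuous =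
      cellClass (pd j (pd i v)) (c2 j i).continuous := cellClass_congr _ _ (pd_comm hv i j)
  have h1 := inner_pd_right (c1 i) (c2 j j) (p1 i) (p2 j j) i
  have h2 := inner_pd_right (c1 i) (c2 i j) (p1 i) (p2 i j) j
  rw [e1, h2, neg_inj, e2] at h1
  exact h1.symm

theorem energy_identity_of_smoothPeriodic (lam : ℝ) {w : L2Y n} (hw : w ∈ smoothPeriodic n) :
    ‖resolventOp lam w‖ ^ 2 = energy lam w := by
  obtain ⟨v, hv, hp, rfl⟩ := mem_smoothPeriodic_iff.1 hw
  rw [(isWeakJet_cellClass hv).resolventOp_eq, (isWeakJet_cellClass hv).energy_eq]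
  exact norm_sq_smul_sub_sum lam (cellClass v hv.continuous)
    (fun i => cellClass (pd i v) (contDiff_pd hv i).continuous)
    (fun i j => cellClass (pd j (pd i v)) (contDiff_pd (contDiff_pd hv i) j).continuous)
    (fun i => inner_pd_right hv (contDiff_pd hv i) hp (hp.pd i) i) (inner_pd_pd hv hp)

/-! ### Approximation in `H²_per(Y)` -/

section Approximation

open Filter Topology

theorem norm_le_h2Norm (u : L2Y n) : ‖u‖ ≤ h2Norm u := by
  refine Real.le_sqrt_of_sq_le ?_
  have h1 : 0 ≤ ∑ i, ‖weakPartial i u‖ ^ 2 := Finset.sum_nonneg fun i _ => sq_nonneg _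
  have h2 : 0 ≤ ∑ i, ∑ j, ‖weakPartial₂ i j u‖ ^ 2 :=
    Finset.sum_nonneg fun i _ => Finset.sum_nonneg fun j _ => sq_nonneg _
  exact le_add_of_le_of_nonneg (le_add_of_nonneg_right h1) h2

theorem norm_weakPartial_le_h2Norm (u : L2Y n) (i : Fin n) : ‖weakPartial i u‖ ≤ h2Norm u := by
  refine Real.le_sqrt_of_sq_le ?_
  have h1 : ‖weakPartial i u‖ ^ 2 ≤ ∑ i, ‖weakPartial i u‖ ^ 2 :=
    Finset.single_le_sum (f := fun i => ‖weakPartial i u‖ ^ 2) (fun i _ => sq_nonneg _)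
      (Finset.mem_univ i)
  have h2 : 0 ≤ ∑ i, ∑ j, ‖weakPartial₂ i j u‖ ^ 2 :=
    Finset.sum_nonneg fun i _ => Finset.sum_nonneg fun j _ => sq_nonneg _
  exact le_add_of_le_of_nonneg (le_add_of_nonneg_of_le (sq_nonneg _) h1) h2

theorem norm_weakPartial₂_le_h2Norm (u : L2Y n) (i j : Fin n) :
    ‖weakPartial₂ i j u‖ ≤ h2Norm u := by
  refine Real.le_sqrt_of_sq_le ?_
  have h1 : ‖weakPartial₂ i j u‖ ^ 2 ≤ ∑ j, ‖weakPartial₂ i j u‖ ^ 2 :=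
    Finset.single_le_sum (f := fun j => ‖weakPartial₂ i j u‖ ^ 2) (fun i _ => sq_nonneg _)
      (Finset.mem_univ j)
  have h2 : ∑ j, ‖weakPartial₂ i j u‖ ^ 2 ≤ ∑ i, ∑ j, ‖weakPartial₂ i j u‖ ^ 2 :=
    Finset.single_le_sum (f := fun i => ∑ j, ‖weakPartial₂ i j u‖ ^ 2)
      (fun i _ => Finset.sum_nonneg fun j _ => sq_nonneg _) (Finset.mem_univ i)
  have h3 : 0 ≤ ∑ i, ‖weakPartial i u‖ ^ 2 := Finset.sum_nonneg fun i _ => sq_nonneg _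
  exact le_add_of_nonneg_of_le (add_nonneg (sq_nonneg _) h3) (h1.trans h2)

/-- The sequence `w` converges to `u` together with its weak derivatives up to order two. -/
structure JetTendsto (w : ℕ → L2Y n) (u : L2Y n) (p : Fin n → L2Y n)
    (q : Fin n → Fin n → L2Y n) : Prop where
  val : Tendsto w atTop (𝓝 u)
  grad : ∀ i, Tendsto (fun m => weakPartial i (w m)) atTop (𝓝 (p i))
  hess : ∀ i j, Tendsto (fun m => weakPartial₂ i j (w m)) atTop (𝓝 (q i j))

theorem JetTendsto.isWeakJet {w : ℕ → L2Y n} {u : L2Y n} {p : Fin n → L2Y n}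
    {q : Fin n → Fin n → L2Y n} (h : JetTendsto w u p q) (hw : ∀ m, w m ∈ H2 n) :
    IsWeakJet u p q :=
  ⟨fun i => .of_tendsto (fun m => (isWeakJet_of_mem_H2 (hw m)).grad i) h.val (h.grad i),
    fun i j => .of_tendsto (fun m => (isWeakJet_of_mem_H2 (hw m)).hess i j)
      (h.grad i) (h.hess i j)⟩

/-- Sequential form of the closure. Membership in `H²(Y)` need not be required on the right, because
limits of weak jets are weak jets; this is what makes passing to the limit from smooth functions
easy. -/
theorem mem_H2per_iff {u : L2Y n} : u ∈ H2per n ↔ ∃ w : ℕ → L2Y n,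
    (∀ m, w m ∈ smoothPeriodic n) ∧ ∃ p q, JetTendsto w u p q := by
  constructor
  · rintro ⟨hu, h⟩
    choose w hw hlt using fun m : ℕ => h (1 / ((m : ℝ) + 1)) (by positivity)
    have hlim : Tendsto (fun m => h2Norm (u - w m)) atTop (𝓝 0) :=
      squeeze_zero (fun m => Real.sqrt_nonneg _) (fun m => (hlt m).le)
        tendsto_one_div_add_atTop_nhds_zero_nat
    have hwH (m) := smoothPeriodic_subset_H2 (hw m)
    refine ⟨w, hw, fun i => weakPartial i u, fun i j => weakPartial₂ i j u, ?_, fun i => ?_,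
      fun i j => ?_⟩
    · rw [tendsto_iff_norm_sub_tendsto_zero]
      refine squeeze_zero (fun _ => norm_nonneg _) (fun m => ?_) hlim
      rw [norm_sub_rev]
      exact norm_le_h2Norm _
    · rw [tendsto_iff_norm_sub_tendsto_zero]
      refine squeeze_zero (fun _ => norm_nonneg _) (fun m => ?_) hlim
      rw [norm_sub_rev, ← weakPartial_sub hu (hwH m)]
      exact norm_weakPartial_le_h2Norm _ _
    · rw [tendsto_iff_norm_sub_tendsto_zero]
      refine squeeze_zero (fun _ => norm_nonneg _) (fun m => ?_) hlim
      rw [norm_sub_rev, ← weakPartial₂_sub hu (hwH m)]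
      exact norm_weakPartial₂_le_h2Norm _ _ _
  · rintro ⟨w, hw, p, q, h⟩
    have hwH (m) := smoothPeriodic_subset_H2 (hw m)
    have hjet := h.isWeakJet hwH
    refine ⟨hjet.mem_H2, fun ε hε => ?_⟩
    have hlim : Tendsto (fun m => h2Norm (u - w m)) atTop (𝓝 0) := by
      have e (m) : h2Norm (u - w m) = Real.sqrt (‖u - w m‖ ^ 2
          + (∑ i, ‖p i - weakPartial i (w m)‖ ^ 2)
          + ∑ i, ∑ j, ‖q i j - weakPartial₂ i j (w m)‖ ^ 2) := by
        simp only [h2Norm, weakPartial_sub hjet.mem_H2 (hwH m), hjet.weakPartial_eq,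
          weakPartial₂_sub hjet.mem_H2 (hwH m), hjet.weakPartial₂_eq]
      have aux {a : ℕ → L2Y n} {b : L2Y n} (hab : Tendsto a atTop (𝓝 b)) :
          Tendsto (fun m => ‖b - a m‖ ^ 2) atTop (𝓝 0) := by
        simpa using ((tendsto_const_nhds (x := b)).sub hab).norm.pow 2
      simp only [e]
      have := (((aux h.val).add (tendsto_finsetSum Finset.univ fun i _ => aux (h.grad i))).add
        (tendsto_finsetSum Finset.univ fun i _ =>
          tendsto_finsetSum Finset.univ fun j _ => aux (h.hess i j))).sqrt
      simpa using this
    obtain ⟨m, hm⟩ := (hlim.eventually (gt_mem_nhds hε)).exists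
    exact ⟨w m, hw m, hm⟩

theorem JetTendsto.resolventOp {w : ℕ → L2Y n} {u : L2Y n} {p : Fin n → L2Y n}
    {q : Fin n → Fin n → L2Y n} (h : JetTendsto w u p q) (hw : ∀ m, w m ∈ H2 n) (lam : ℝ) :
    Tendsto (fun m => resolventOp lam (w m)) atTop (𝓝 (resolventOp lam u)) := by
  rw [(h.isWeakJet hw).resolventOp_eq]
  exact (h.val.const_smul lam).sub (tendsto_finsetSum _ fun i _ => h.hess i i)

theorem energy_identity (lam : ℝ) {u : L2Y n} (hu : u ∈ H2per n) :
    ‖resolventOp lam u‖ ^ 2 = energy lam u := by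
  obtain ⟨w, hw, p, q, h⟩ := mem_H2per_iff.1 hu
  have hwH (m) := smoothPeriodic_subset_H2 (hw m)
  refine tendsto_nhds_unique ((h.resolventOp hwH lam).norm.pow 2) ?_
  simp only [energy_identity_of_smoothPeriodic lam (hw _)]
  rw [(h.isWeakJet hwH).energy_eq]
  exact ((tendsto_finsetSum _ fun i _ => tendsto_finsetSum _ fun j _ =>
    (h.hess i j).norm.pow 2).add ((tendsto_finsetSum _ fun i _ =>
      (h.grad i).norm.pow 2).const_mul _)).add ((h.val.norm.pow 2).const_mul _)

theorem sub_mem_H2per {u v : L2Y n} (hu : u ∈ H2per n) (hv : v ∈ H2per n) : u - v ∈ H2per n := by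
  obtain ⟨w, hw, p, q, h⟩ := mem_H2per_iff.1 hu
  obtain ⟨w', hw', p', q', h'⟩ := mem_H2per_iff.1 hv
  have hH (m) := smoothPeriodic_subset_H2 (hw m)
  have hH' (m) := smoothPeriodic_subset_H2 (hw' m)
  refine mem_H2per_iff.2 ⟨fun m => w m - w' m, fun m => sub_mem_smoothPeriodic (hw m) (hw' m),
    p - p', q - q', h.val.sub h'.val, fun i => ?_, fun i j => ?_⟩
  · simp only [weakPartial_sub (hH _) (hH' _)]
    exact (h.grad i).sub (h'.grad i)
  · simp only [weakPartial₂_sub (hH _) (hH' _)]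
    exact (h.hess i j).sub (h'.hess i j)

/-- Closed range. The energy identity for the differences `w m - w l` makes all derivatives up to
order two Cauchy as soon as the images are, and `L²(Y)` is complete. -/
theorem mem_H2per_of_tendsto_resolventOp {lam : ℝ} (hlam : 0 < lam) {w : ℕ → L2Y n}
    (hw : ∀ m, w m ∈ smoothPeriodic n) {g : L2Y n}
    (hg : Tendsto (fun m => resolventOp lam (w m)) atTop (𝓝 g)) :
    ∃ u ∈ H2per n, resolventOp lam u = g := by
  have hH (m) := smoothPeriodic_subset_H2 (hw m)
  have hcs := hg.cauchySeq
  have hE (m l) : ‖resolventOp lam (w m) - resolventOp lam (w l)‖ ^ 2 = energy lam (w m - w l) := by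
    rw [← resolventOp_sub lam (hH m) (hH l),
      energy_identity_of_smoothPeriodic lam (sub_mem_smoothPeriodic (hw m) (hw l))]
  -- `K⁻²` will be the weight of the component in the energy: `λ²` for the values, `2λ` for the
  -- gradient, `1` for the Hessian.
  have transfer (a : ℕ → L2Y n) (K : ℝ) (hK : 0 ≤ K)
      (ha : ∀ m l, ‖a m - a l‖ ^ 2 ≤ K ^ 2 * energy lam (w m - w l)) : CauchySeq a := by
    have hle (m l) : ‖a m - a l‖ ≤ K * ‖resolventOp lam (w m) - resolventOp lam (w l)‖ := by
      refine (sq_le_sq₀ (norm_nonneg _) (by positivity)).1 ?_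
      rw [mul_pow, hE]
      exact ha m l
    rw [Metric.cauchySeq_iff] at hcs ⊢
    intro ε hε
    -- `K + 1` rather than `K`, because `K = 0` is allowed.
    obtain ⟨N, hN⟩ := hcs (ε / (K + 1)) (by positivity)
    refine ⟨N, fun m hm l hl => ?_⟩
    rw [dist_eq_norm]
    have h1 := hN m hm l hl
    rw [dist_eq_norm, lt_div_iff₀ (by positivity)] at h1
    have := hle m l
    nlinarith [norm_nonneg (resolventOp lam (w m) - resolventOp lam (w l))]
  have n1 (x : L2Y n) : 0 ≤ ∑ i, ‖weakPartial i x‖ ^ 2 := by positivity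
  have n2 (x : L2Y n) : 0 ≤ ∑ i, ∑ j, ‖weakPartial₂ i j x‖ ^ 2 := by positivity
  have c0 : CauchySeq w := by
    refine transfer w lam⁻¹ (by positivity) fun m l => ?_
    rw [inv_pow, inv_mul_eq_div, le_div_iff₀ (by positivity)]
    have := mul_nonneg (mul_nonneg zero_le_two hlam.le) (n1 (w m - w l))
    have := n2 (w m - w l)
    simp only [energy]
    linarith
  have c1 (i : Fin n) : CauchySeq fun m => weakPartial i (w m) := by
    refine transfer _ (Real.sqrt (2 * lam)⁻¹) (by positivity) fun m l => ?_
    rw [Real.sq_sqrt (by positivity), inv_mul_eq_div, le_div_iff₀ (by positivity),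
      ← weakPartial_sub (hH m) (hH l)]
    have h1 : ‖weakPartial i (w m - w l)‖ ^ 2 ≤ ∑ i, ‖weakPartial i (w m - w l)‖ ^ 2 :=
      Finset.single_le_sum (f := fun i => ‖weakPartial i (w m - w l)‖ ^ 2)
        (fun i _ => by positivity) (Finset.mem_univ i)
    have h2 := n2 (w m - w l)
    have h3 : 0 ≤ lam ^ 2 * ‖w m - w l‖ ^ 2 := by positivity
    have h4 := mul_le_mul_of_nonneg_left h1 (by positivity : (0 : ℝ) ≤ 2 * lam)
    simp only [energy]
    linarith
  have c2 (i j : Fin n) : CauchySeq fun m => weakPartial₂ i j (w m) := by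
    refine transfer _ 1 zero_le_one fun m l => ?_
    rw [one_pow, one_mul, ← weakPartial₂_sub (hH m) (hH l)]
    have h1 : ‖weakPartial₂ i j (w m - w l)‖ ^ 2 ≤ ∑ j, ‖weakPartial₂ i j (w m - w l)‖ ^ 2 :=
      Finset.single_le_sum (f := fun j => ‖weakPartial₂ i j (w m - w l)‖ ^ 2)
        (fun i _ => by positivity) (Finset.mem_univ j)
    have h2 : ∑ j, ‖weakPartial₂ i j (w m - w l)‖ ^ 2 ≤
        ∑ i, ∑ j, ‖weakPartial₂ i j (w m - w l)‖ ^ 2 :=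
      Finset.single_le_sum (f := fun i => ∑ j, ‖weakPartial₂ i j (w m - w l)‖ ^ 2)
        (fun i _ => by positivity) (Finset.mem_univ i)
    have h3 := mul_nonneg (mul_nonneg zero_le_two hlam.le) (n1 (w m - w l))
    have h4 : 0 ≤ lam ^ 2 * ‖w m - w l‖ ^ 2 := by positivity
    simp only [energy]
    linarith
  obtain ⟨u, hu⟩ := cauchySeq_tendsto_of_complete c0
  choose p hp using fun i => cauchySeq_tendsto_of_complete (c1 i)
  choose q hq using fun i j => cauchySeq_tendsto_of_complete (c2 i j)
  have hJ : JetTendsto w u p q := ⟨hu, hp, hq⟩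
  exact ⟨u, mem_H2per_iff.2 ⟨w, hw, p, q, hJ⟩, tendsto_nhds_unique (hJ.resolventOp hH lam) hg⟩

end Approximation

/-! ### Trigonometric modes -/

theorem inner_basisVec (κ : Space n) (i : Fin n) : inner ℝ κ (basisVec i) = κ i := by
  simp [EuclideanSpace.inner_single_right]

theorem pd_cos_inner (κ : Space n) (i : Fin n) :
    pd i (fun y => Real.cos (inner ℝ κ y)) = fun y => -κ i * Real.sin (inner ℝ κ y) := by
  ext y
  have h : HasFDerivAt (fun y => Real.cos (inner ℝ κ y)) _ y :=
    (innerSL ℝ κ).hasFDerivAt.cos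
  simp [pd, h.fderiv, innerSL_apply_apply, inner_basisVec]
  ring

theorem pd_sin_inner (κ : Space n) (i : Fin n) :
    pd i (fun y => Real.sin (inner ℝ κ y)) = fun y => κ i * Real.cos (inner ℝ κ y) := by
  ext y
  have h : HasFDerivAt (fun y => Real.sin (inner ℝ κ y)) _ y :=
    (innerSL ℝ κ).hasFDerivAt.sin
  simp [pd, h.fderiv, innerSL_apply_apply, inner_basisVec]
  ring

theorem pd_const_mul {v : Space n → ℝ} (hv : ContDiff ℝ ∞ v) (r : ℝ) (i : Fin n) (y : Space n) :
    pd i (fun z => r * v z) y = r * pd i v y := by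
  simp [pd, fderiv_const_mul (hv.differentiable (by simp) y)]

theorem contDiff_cos_inner (κ : Space n) : ContDiff ℝ ∞ fun y => Real.cos (inner ℝ κ y) :=
  Real.contDiff_cos.comp (innerSL ℝ κ).contDiff

theorem contDiff_sin_inner (κ : Space n) : ContDiff ℝ ∞ fun y => Real.sin (inner ℝ κ y) :=
  Real.contDiff_sin.comp (innerSL ℝ κ).contDiff

theorem pd_pd_cos_inner (κ : Space n) (i : Fin n) (y : Space n) :
    pd i (pd i fun y => Real.cos (inner ℝ κ y)) y = -κ i ^ 2 * Real.cos (inner ℝ κ y) := by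
  rw [pd_cos_inner, pd_const_mul (contDiff_sin_inner κ), pd_sin_inner]
  ring

theorem pd_pd_sin_inner (κ : Space n) (i : Fin n) (y : Space n) :
    pd i (pd i fun y => Real.sin (inner ℝ κ y)) y = -κ i ^ 2 * Real.sin (inner ℝ κ y) := by
  rw [pd_sin_inner, pd_const_mul (contDiff_cos_inner κ), pd_cos_inner]
  ring

/-- The frequency vector `2πk`. -/
def freq (k : Fin n → ℤ) : Space n := WithLp.toLp 2 fun i => k i * (2 * Real.pi)

theorem inner_freq_add (k : Fin n → ℤ) (i : Fin n) (y : Space n) :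
    inner ℝ (freq k) (y + basisVec i) = inner ℝ (freq k) y + k i * (2 * Real.pi) := by
  rw [inner_add_right, inner_basisVec]
  rfl

/-- The hypothesis is phrased to cover sines and cosines alike; for `λ > 0` the eigenvalue `λ +
|κ|²` never vanishes. -/
theorem resolventOp_eigenfunction (lam : ℝ) {v : Space n → ℝ} (hv : ContDiff ℝ ∞ v) (κ : Space n)
    (h : ∀ i y, pd i (pd i v) y = -κ i ^ 2 * v y) :
    resolventOp lam (cellClass v hv.continuous) =
      (lam + ∑ i, κ i ^ 2) • cellClass v hv.continuous := by
  rw [(isWeakJet_cellClass hv).resolventOp_eq]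
  have e (i : Fin n) : cellClass (pd i (pd i v)) (contDiff_pd (contDiff_pd hv i) i).continuous =
      (-κ i ^ 2) • cellClass v hv.continuous := by
    rw [cellClass_congr _ (hv.continuous.const_smul (-κ i ^ 2)) (h i)]
    exact MemLp.toLp_const_smul _ _
  simp only [e]
  rw [← Finset.sum_smul, ← sub_smul, Finset.sum_neg_distrib, sub_neg_eq_add]

/-! ### Completeness of the trigonometric system -/

section Torus

open UnitAddTorus

-- Makes `volume` on the torus the product of normalised Haar measures, for which the Fourier modes
-- are orthonormal.
local instance : MeasureSpace UnitAddCircle := ⟨AddCircle.haarAddCircle⟩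

theorem integral_comp_of_measurePreserving {α β E : Type*} [MeasurableSpace α] [MeasurableSpace β]
    [NormedAddCommGroup E] [NormedSpace ℝ E] {μ : Measure α} {ν : Measure β} {φ : α → β}
    (hφ : MeasurePreserving φ μ ν) {F : β → E} (hF : AEStronglyMeasurable F ν) :
    ∫ t, F (φ t) ∂μ = ∫ y, F y ∂ν := by
  rw [← hφ.map_eq] at hF ⊢
  exact (integral_map hφ.measurable.aemeasurable hF).symm

/-- A section `(ℝ/ℤ)ⁿ → (0,1]ⁿ ⊆ ℝⁿ` of the quotient map. -/
def torusSection (t : UnitAddTorus (Fin n)) : Space n :=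
  WithLp.toLp 2 (measurableEquivPiIoc (0 : Fin n → ℝ) t).1

theorem coe_torusSection (t : UnitAddTorus (Fin n)) :
    (fun i => (torusSection t i : UnitAddCircle)) = t := by
  exact (measurableEquivPiIoc (0 : Fin n → ℝ)).symm_apply_apply t

/-- The torus is identified with the half-open cube, which differs from the open cell by a null set
of faces; lastly the norm on `ℝⁿ` is changed. Hence integrals over the cell can be computed on the
torus. -/
theorem measurePreserving_torusSection :
    MeasurePreserving (torusSection (n := n)) volume (cellMeasure n) := by
  have h1 := measurePreserving_equivPiIoc (0 : Fin n → ℝ)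
  have hS : MeasurableSet
      {x : Fin n → ℝ | ∀ i, x i ∈ Ioc ((0 : Fin n → ℝ) i) ((0 : Fin n → ℝ) i + 1)} :=
    MeasurableSet.univ_pi' fun i => measurableSet_Ioc
  have h2 := measurePreserving_subtype_coe (μa := volume) hS
  have hset : ({x : Fin n → ℝ | ∀ i, x i ∈ Ioc ((0 : Fin n → ℝ) i) ((0 : Fin n → ℝ) i + 1)} : Set _)
      =ᵐ[volume] (univ.pi fun _ : Fin n => Ioo (0 : ℝ) 1) := by
    have : {x : Fin n → ℝ | ∀ i, x i ∈ Ioc ((0 : Fin n → ℝ) i) ((0 : Fin n → ℝ) i + 1)} =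
        univ.pi fun _ : Fin n => Ioc (0 : ℝ) 1 := by
      ext x; simp
    rw [this]
    exact (Measure.univ_pi_Ioc_ae_eq_Icc (f := fun _ : Fin n => (0 : ℝ)) (g := fun _ => 1)).trans
      Measure.univ_pi_Ioo_ae_eq_Icc.symm
  rw [Measure.restrict_congr_set hset] at h2
  have h3 : MeasurePreserving (WithLp.toLp 2 : (Fin n → ℝ) → Space n)
      (volume.restrict (univ.pi fun _ : Fin n => Ioo (0 : ℝ) 1)) (cellMeasure n) := by
    have := (PiLp.volume_preserving_toLp (Fin n)).restrict_preimage
      (isOpen_unitCell (n := n)).measurableSet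
    rw [show cellMeasure n = _ from congrArg volume.restrict unitCell_eq_preimage]
    rw [unitCell_eq_preimage] at this
    exact this
  exact h3.comp (h2.comp h1)

theorem mFourier_neg_torusSection (k : Fin n → ℤ) (t : UnitAddTorus (Fin n)) :
    mFourier (-k) t = (Real.cos (inner ℝ (freq k) (torusSection t)) : ℂ)
      - (Real.sin (inner ℝ (freq k) (torusSection t)) : ℂ) * Complex.I := by
  conv_lhs => rw [← coe_torusSection t]
  have : inner ℝ (freq k) (torusSection t) = ∑ i, k i * (2 * Real.pi) * torusSection t i := by
    simp [PiLp.inner_apply, freq, mul_comm]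
  rw [this]
  generalize torusSection t = y
  simp only [mFourier, ContinuousMap.coe_mk, Pi.neg_apply, fourier_coe_apply, ← Complex.exp_sum]
  rw [Complex.ofReal_cos, Complex.ofReal_sin, Complex.cos_sub_sin_I]
  congr 1
  push_cast
  rw [← Finset.sum_neg_distrib, Finset.sum_mul]
  refine Finset.sum_congr rfl fun i _ => ?_
  ring

/-- Pulled back to the torus and viewed as complex-valued, `g` has vanishing Fourier coefficients,
hence is zero because `mFourierBasis` is a Hilbert basis. -/
theorem eq_zero_of_integral_cos_sin {g : L2Y n}
    (hc : ∀ k : Fin n → ℤ, ∫ y in unitCell n, g y * Real.cos (inner ℝ (freq k) y) = 0)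
    (hs : ∀ k : Fin n → ℤ, ∫ y in unitCell n, g y * Real.sin (inner ℝ (freq k) y) = 0) :
    g = 0 := by
  have hP := measurePreserving_torusSection (n := n)
  have hG : MemLp (fun t => ((g (torusSection t) : ℝ) : ℂ)) 2
      (volume : Measure (UnitAddTorus (Fin n))) :=
    ((Lp.memLp g).comp_measurePreserving hP).ofReal
  have hcoeff (k : Fin n → ℤ) : mFourierCoeff (hG.toLp _) k = 0 := by
    have h1 : mFourierCoeff (hG.toLp _) k =
        ∫ t, (fun y : Space n => ((Real.cos (inner ℝ (freq k) y) : ℂ)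
          - (Real.sin (inner ℝ (freq k) y) : ℂ) * Complex.I) * (g y : ℂ)) (torusSection t) := by
      refine integral_congr_ae ?_
      filter_upwards [hG.coeFn_toLp] with t ht
      rw [ht, mFourier_neg_torusSection, smul_eq_mul]
    have ic : Integrable (fun y => g y * Real.cos (inner ℝ (freq k) y)) (cellMeasure n) :=
      (memLp_of_continuous (contDiff_cos_inner (freq k)).continuous).integrable_mul (Lp.memLp g)
        |>.congr (.of_forall fun y => mul_comm _ _)
    have is : Integrable (fun y => g y * Real.sin (inner ℝ (freq k) y)) (cellMeasure n) :=
      (memLp_of_continuous (contDiff_sin_inner (freq k)).continuous).integrable_mul (Lp.memLp g)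
        |>.congr (.of_forall fun y => mul_comm _ _)
    have e : (fun y : Space n => ((Real.cos (inner ℝ (freq k) y) : ℂ)
          - (Real.sin (inner ℝ (freq k) y) : ℂ) * Complex.I) * (g y : ℂ)) =
        fun y => ((g y * Real.cos (inner ℝ (freq k) y) : ℝ) : ℂ)
          - ((g y * Real.sin (inner ℝ (freq k) y) : ℝ) : ℂ) * Complex.I := by
      ext y; push_cast; ring
    have hm := (ic.ofReal (𝕜 := ℂ)).sub ((is.ofReal (𝕜 := ℂ)).mul_const Complex.I)
    rw [h1, e]
    refine (integral_comp_of_measurePreserving hP hm.aestronglyMeasurable).trans ?_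
    erw [integral_sub ic.ofReal (is.ofReal.mul_const _), integral_mul_const, integral_ofReal,
      integral_ofReal, hc, integral_ofReal, hs]
    simp
  have h0 : hG.toLp _ = 0 := by
    have hr : mFourierBasis.repr (hG.toLp _) = 0 := by
      ext k
      rw [mFourierBasis_repr, hcoeff]
      rfl
    simpa using hr
  rw [Lp.eq_zero_iff_ae_eq_zero] at h0
  have h2 : ∀ᵐ t ∂(volume : Measure (UnitAddTorus (Fin n))), g (torusSection t) = 0 := by
    filter_upwards [h0, hG.coeFn_toLp] with t ht ht'
    rw [ht] at ht'
    exact Complex.ofReal_eq_zero.1 ht'.symm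
  rw [Lp.eq_zero_iff_ae_eq_zero]
  have h3 := (ae_map_iff hP.measurable.aemeasurable
    (measurableSet_eq_fun (Lp.stronglyMeasurable g).measurable measurable_const)).2 h2
  rwa [hP.map_eq] at h3

end Torus

/-! ### Surjectivity of `lam - Δ` -/

/-- The image of `C^∞_per(Y)` under `lam - Δ`. -/
def resolventRange (n : ℕ) (lam : ℝ) : Submodule ℝ (L2Y n) where
  carrier := resolventOp lam '' smoothPeriodic n
  zero_mem' := by
    have h0 : (0 : L2Y n) ∈ smoothPeriodic n :=
      ⟨0, contDiff_const, fun _ _ => rfl, Lp.coeFn_zero _ _ _⟩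
    refine ⟨0, h0, ?_⟩
    have := resolventOp_sub lam (smoothPeriodic_subset_H2 h0) (smoothPeriodic_subset_H2 h0)
    simpa using this
  add_mem' := by
    rintro _ _ ⟨w, hw, rfl⟩ ⟨w', hw', rfl⟩
    refine ⟨w + w', add_mem_smoothPeriodic hw hw', ?_⟩
    -- Additivity is read off from `w = (w + w') - w'`.
    have := resolventOp_sub lam (smoothPeriodic_subset_H2 (add_mem_smoothPeriodic hw hw'))
      (smoothPeriodic_subset_H2 hw')
    rw [add_sub_cancel_right] at this
    rw [this, sub_add_cancel]
  smul_mem' := by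
    rintro r _ ⟨w, hw, rfl⟩
    refine ⟨r • w, smul_mem_smoothPeriodic r hw, ?_⟩
    have h := isWeakJet_of_mem_H2 (smoothPeriodic_subset_H2 hw)
    rw [(h.smul r).resolventOp_eq, h.resolventOp_eq, smul_sub, smul_comm, Finset.smul_sum]
    rfl

/-- A function orthogonal to the range is orthogonal to `(λ + |κ|²) v` for every trigonometric mode
`v`, hence to `v` itself, and the modes are complete. -/
theorem resolventRange_topologicalClosure {lam : ℝ} (hlam : 0 < lam) :
    (resolventRange n lam).topologicalClosure = ⊤ := by
  rw [Submodule.topologicalClosure_eq_top_iff, Submodule.eq_bot_iff]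
  intro g hg
  rw [Submodule.mem_orthogonal] at hg
  have key {v : Space n → ℝ} (hv : ContDiff ℝ ∞ v) (hp : YPeriodic v) (κ : Space n)
      (h : ∀ i y, pd i (pd i v) y = -κ i ^ 2 * v y) : ∫ y in unitCell n, g y * v y = 0 := by
    have hmem : resolventOp lam (cellClass v hv.continuous) ∈ resolventRange n lam :=
      ⟨_, mem_smoothPeriodic_iff.2 ⟨v, hv, hp, rfl⟩, rfl⟩
    have h0 := hg _ hmem
    rw [resolventOp_eigenfunction lam hv κ h, inner_smul_left, inner_cellClass] at h0
    refine (mul_eq_zero.1 h0).resolve_left ?_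
    have : 0 < lam + ∑ i, κ i ^ 2 := by positivity
    simpa using this.ne'
  refine eq_zero_of_integral_cos_sin (fun k => ?_) fun k => ?_
  · refine key (contDiff_cos_inner (freq k)) (fun i y => ?_) (freq k) (pd_pd_cos_inner _)
    simp only [inner_freq_add, Real.cos_add_int_mul_two_pi]
  · refine key (contDiff_sin_inner (freq k)) (fun i y => ?_) (freq k) (pd_pd_sin_inner _)
    simp only [inner_freq_add, Real.sin_add_int_mul_two_pi]

theorem exists_resolventOp_eq {lam : ℝ} (hlam : 0 < lam) (g : L2Y n) :
    ∃ u ∈ H2per n, resolventOp lam u = g := by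
  have hg : g ∈ closure (resolventOp lam '' smoothPeriodic n) := by
    have : g ∈ (resolventRange n lam).topologicalClosure := by
      rw [resolventRange_topologicalClosure hlam]
      trivial
    exact this
  obtain ⟨a, ha, hlim⟩ := mem_closure_iff_seq_limit.1 hg
  choose w hw he using ha
  exact mem_H2per_of_tendsto_resolventOp hlam hw (by simpa only [he] using hlim)

/-! ### Inf-sup of continuous functions over compact spaces -/

section InfSup

variable {X 𝒜 ℬ : Type*} [TopologicalSpace X] [TopologicalSpace 𝒜] [TopologicalSpace ℬ]
  [CompactSpace ℬ]

theorem continuous_iSup_of_compactSpace {G : X × ℬ → ℝ} (hG : Continuous G) :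
    Continuous fun x => ⨆ β, G (x, β) := by
  have := isCompact_univ.continuous_sSup (f := fun x β => G (x, β)) hG
  simpa only [image_univ, sSup_range, sInf_range] using this

theorem continuous_iInf_of_compactSpace {G : X × ℬ → ℝ} (hG : Continuous G) :
    Continuous fun x => ⨅ β, G (x, β) := by
  have := isCompact_univ.continuous_sInf (f := fun x β => G (x, β)) hG
  simpa only [image_univ, sSup_range, sInf_range] using this

theorem bddAbove_range_right {g : 𝒜 × ℬ → ℝ} (hg : Continuous g) (α : 𝒜) :
    BddAbove (range fun β => g (α, β)) :=
  (isCompact_range (hg.comp (by fun_prop : Continuous fun β => (α, β)))).bddAbove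

variable [CompactSpace 𝒜]

theorem continuous_iInf_iSup {G : X × 𝒜 × ℬ → ℝ} (hG : Continuous G) :
    Continuous fun x => ⨅ α, ⨆ β, G (x, α, β) := by
  have h1 : Continuous fun z : X × 𝒜 => ⨆ β, G (z.1, z.2, β) :=
    continuous_iSup_of_compactSpace (G := fun z : (X × 𝒜) × ℬ => G (z.1.1, z.1.2, z.2))
      (hG.comp (by fun_prop))
  exact continuous_iInf_of_compactSpace h1

theorem bddBelow_range_iSup {g : 𝒜 × ℬ → ℝ} (hg : Continuous g) :
    BddBelow (range fun α => ⨆ β, g (α, β)) :=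
  (isCompact_range (continuous_iSup_of_compactSpace hg)).bddBelow

variable [Nonempty 𝒜] [Nonempty ℬ]

theorem iInf_iSup_le_add {g h : 𝒜 × ℬ → ℝ} (hg : Continuous g) (hh : Continuous h) {k : ℝ}
    (hle : ∀ z, g z ≤ h z + k) : ⨅ α, ⨆ β, g (α, β) ≤ (⨅ α, ⨆ β, h (α, β)) + k := by
  rw [← sub_le_iff_le_add]
  refine le_ciInf fun α => ?_
  rw [sub_le_iff_le_add]
  refine (ciInf_le (bddBelow_range_iSup hg) α).trans (ciSup_le fun β => ?_)
  exact (hle (α, β)).trans (by gcongr; exact le_ciSup (bddAbove_range_right hh α) β)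

/-- Inf-sup is monotone and commutes with adding constants. Here `d` will be the increment of `λ -
Δ`, which does not depend on the parameters. -/
theorem abs_iInf_iSup_sub_sub_le {g h : 𝒜 × ℬ → ℝ} (hg : Continuous g) (hh : Continuous h)
    {d k : ℝ} (hle : ∀ z, |g z - h z - d| ≤ k) :
    |(⨅ α, ⨆ β, g (α, β)) - (⨅ α, ⨆ β, h (α, β)) - d| ≤ k := by
  have h1 := iInf_iSup_le_add hg hh (k := d + k) fun z => by
    have := (abs_le.1 (hle z)).2
    linarith
  have h2 := iInf_iSup_le_add hh hg (k := k - d) fun z => by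
    have := (abs_le.1 (hle z)).1
    linarith
  rw [abs_le]
  constructor <;> linarith

/-- Compactness makes the infimum and the suprema attained, so the condition depends only on the
signs of `g`. -/
theorem iInf_iSup_eq_zero_iff {g : 𝒜 × ℬ → ℝ} (hg : Continuous g) :
    ⨅ α, ⨆ β, g (α, β) = 0 ↔ (∀ α, ∃ β, 0 ≤ g (α, β)) ∧ ∃ α, ∀ β, g (α, β) ≤ 0 := by
  have hcont := continuous_iSup_of_compactSpace hg
  constructor
  · intro h0
    constructor
    · intro α
      obtain ⟨β, -, hβ⟩ := isCompact_univ.exists_isMaxOn univ_nonempty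
        (hg.comp (by fun_prop : Continuous fun β => (α, β))).continuousOn
      refine ⟨β, ?_⟩
      calc (0 : ℝ) ≤ ⨆ β, g (α, β) := h0 ▸ ciInf_le (bddBelow_range_iSup hg) α
        _ ≤ g (α, β) := ciSup_le fun β' => hβ (mem_univ β')
    · obtain ⟨α, -, hα⟩ := isCompact_univ.exists_isMinOn univ_nonempty hcont.continuousOn
      refine ⟨α, fun β => ?_⟩
      calc g (α, β) ≤ ⨆ β, g (α, β) := le_ciSup (bddAbove_range_right hg α) β
        _ ≤ ⨅ α, ⨆ β, g (α, β) := le_ciInf fun α' => hα (mem_univ α')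
        _ = 0 := h0
  · rintro ⟨h1, α, h2⟩
    refine le_antisymm ((ciInf_le (bddBelow_range_iSup hg) α).trans (ciSup_le h2))
      (le_ciInf fun α' => ?_)
    obtain ⟨β, hβ⟩ := h1 α'
    exact hβ.trans (le_ciSup (bddAbove_range_right hg α') β)

theorem iInf_iSup_mul_eq_zero_iff {g γ : 𝒜 × ℬ → ℝ} (hg : Continuous g) (hγ : Continuous γ)
    (hpos : ∀ z, 0 < γ z) :
    ⨅ α, ⨆ β, γ (α, β) * g (α, β) = 0 ↔ ⨅ α, ⨆ β, g (α, β) = 0 := by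
  rw [iInf_iSup_eq_zero_iff hg, iInf_iSup_eq_zero_iff (g := fun z => γ z * g z) (hγ.mul hg)]
  simp only [mul_nonneg_iff_of_pos_left (hpos _), mul_nonpos_iff_pos_imp_nonpos]
  simp [hpos, (hpos _).le]

end InfSup

/-! ### The Cordes condition -/

theorem frob_comm (M N : Matrix (Fin n) (Fin n) ℝ) : frob M N = frob N M := by
  simp only [frob, mul_comm]

theorem frob_self_nonneg (M : Matrix (Fin n) (Fin n) ℝ) : 0 ≤ frob M M :=
  Finset.sum_nonneg fun _ _ => Finset.sum_nonneg fun _ _ => mul_self_nonneg _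

theorem frob_sub_right (M N P : Matrix (Fin n) (Fin n) ℝ) :
    frob M (N - P) = frob M N - frob M P := by
  simp only [frob, Matrix.sub_apply, mul_sub, Finset.sum_sub_distrib]

theorem frob_sub_left (M N P : Matrix (Fin n) (Fin n) ℝ) :
    frob (M - N) P = frob M P - frob N P := by
  simp only [frob, Matrix.sub_apply, sub_mul, Finset.sum_sub_distrib]

theorem frob_smul_left (r : ℝ) (M N : Matrix (Fin n) (Fin n) ℝ) :
    frob (r • M) N = r * frob M N := by
  simp only [frob, Matrix.smul_apply, smul_eq_mul, Finset.mul_sum, mul_assoc]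

theorem frob_one_left (M : Matrix (Fin n) (Fin n) ℝ) : frob 1 M = M.trace := by
  simp [frob, Matrix.one_apply, Matrix.trace]

theorem frob_sq_le (M N : Matrix (Fin n) (Fin n) ℝ) :
    frob M N ^ 2 ≤ frob M M * frob N N := by
  have h := Finset.sum_mul_sq_le_sq_mul_sq (Finset.univ : Finset (Fin n × Fin n))
    (fun z => M z.1 z.2) (fun z => N z.1 z.2)
  simp only [Fintype.sum_prod_type, sq (M _ _), sq (N _ _)] at h
  exact h

/-- Cauchy–Schwarz for an orthogonal sum, from its two summands; two uses join the Hessian, gradient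
and value parts of a jet. -/
theorem add_sq_le_of_sq_le_mul {x y a b c d : ℝ} (ha : 0 ≤ a) (hb : 0 ≤ b) (hc : 0 ≤ c)
    (hd : 0 ≤ d) (hx : x ^ 2 ≤ a * b) (hy : y ^ 2 ≤ c * d) :
    (x + y) ^ 2 ≤ (a + c) * (b + d) := by
  have h1 : x ^ 2 * y ^ 2 ≤ (a * b) * (c * d) := by gcongr
  have h2 : 2 * (x * y) ≤ a * d + c * b := by
    refine (abs_le.1 (abs_le_of_sq_le_sq ?_ (by positivity))).2
    nlinarith [sq_nonneg (a * d - c * b)]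
  nlinarith

/-- The square of the `lam`-weighted norm of a `2`-jet. -/
def jetSq (lam r : ℝ) (ξ : Space n) (M : Matrix (Fin n) (Fin n) ℝ) : ℝ :=
  frob M M + 2 * lam * ‖ξ‖ ^ 2 + lam ^ 2 * r ^ 2

/-- The quantity `|A|² + |b|²/(2 lam) + c²/lam²`. -/
def cordesDenom (lam : ℝ) (A : Matrix (Fin n) (Fin n) ℝ) (b : Space n) (c : ℝ) : ℝ :=
  frob A A + ‖b‖ ^ 2 / (2 * lam) + c ^ 2 / lam ^ 2

/-- The renormalisation factor `(tr A + c / lam) / (|A|² + |b|²/(2 lam) + c²/lam²)`. -/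
def cordesScale (lam : ℝ) (A : Matrix (Fin n) (Fin n) ℝ) (b : Space n) (c : ℝ) : ℝ :=
  (A.trace + c / lam) / cordesDenom lam A b c

/-- With `D` the denominator and `S = tr A + c/λ`, the squared dual distance from `(γA, γb, γc)` to
`(I, 0, λ)` is `γ²D - 2γS + n + 1`. It is minimal at `γ = S/D`, with value `n + 1 - S²/D`, which the
Cordes condition bounds by `1 - δ`. Cauchy–Schwarz with the matching weights does the rest. -/
theorem cordes_estimate {δ lam : ℝ} (hδ : 0 < δ) (hlam : 0 < lam)
    {A : Matrix (Fin n) (Fin n) ℝ} {b : Space n} {c : ℝ} (hpos : 0 < cordesDenom lam A b c)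
    (h : cordesDenom lam A b c ≤ 1 / ((n : ℝ) + δ) * (A.trace + c / lam) ^ 2)
    (r : ℝ) (ξ : Space n) (M : Matrix (Fin n) (Fin n) ℝ) :
    (cordesScale lam A b c * (-frob A M - inner ℝ b ξ + c * r) - (lam * r - M.trace)) ^ 2
      ≤ (1 - δ) * jetSq lam r ξ M := by
  set D := cordesDenom lam A b c with hD
  set γ := cordesScale lam A b c with hγ
  set S := A.trace + c / lam with hS
  have hγD : γ * D = S := div_mul_cancel₀ _ hpos.ne'
  have hfac : frob (γ • A - 1) (γ • A - 1) + γ ^ 2 * ‖b‖ ^ 2 / (2 * lam) + (γ * c / lam - 1) ^ 2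
      ≤ 1 - δ := by
    have e1 : frob (γ • A - 1) (γ • A - 1) = γ ^ 2 * frob A A - 2 * γ * A.trace + n := by
      rw [frob_sub_left, frob_sub_right, frob_smul_left, frob_comm A, frob_smul_left, frob_comm _ 1,
        frob_one_left, frob_one_left, Matrix.trace_sub, Matrix.trace_smul, Matrix.trace_one]
      simp
      ring
    have e2 : frob (γ • A - 1) (γ • A - 1) + γ ^ 2 * ‖b‖ ^ 2 / (2 * lam) + (γ * c / lam - 1) ^ 2
        = γ * (γ * D) - 2 * γ * S + n + 1 := by
      rw [e1, hD, hS, cordesDenom]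
      field_simp
      ring
    have h1 : (n + δ) * D ≤ S ^ 2 := by
      rw [one_div, inv_mul_eq_div, le_div_iff₀ (by positivity)] at h
      linarith
    have h2 : n + δ ≤ γ * S := by
      refine le_of_mul_le_mul_right (h1.trans_eq ?_) hpos
      rw [sq, ← hγD]
      ring
    rw [e2, hγD]
    linarith
  have hb2 : (γ * inner ℝ b ξ) ^ 2 ≤ (γ ^ 2 * ‖b‖ ^ 2 / (2 * lam)) * (2 * lam * ‖ξ‖ ^ 2) := by
    have e : (γ ^ 2 * ‖b‖ ^ 2 / (2 * lam)) * (2 * lam * ‖ξ‖ ^ 2) =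
        γ ^ 2 * (‖b‖ ^ 2 * ‖ξ‖ ^ 2) := by
      field_simp
    rw [e, mul_pow]
    gcongr
    have h2 := abs_real_inner_le_norm b ξ
    rw [← mul_pow, ← sq_abs (inner ℝ b ξ)]
    gcongr
  have hc2 : ((1 - γ * c / lam) * (lam * r)) ^ 2 ≤ (γ * c / lam - 1) ^ 2 * (lam ^ 2 * r ^ 2) :=
    le_of_eq (by ring)
  have key := add_sq_le_of_sq_le_mul (add_nonneg (frob_self_nonneg _) (by positivity))
    (add_nonneg (frob_self_nonneg M) (by positivity)) (sq_nonneg _) (by positivity)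
    (add_sq_le_of_sq_le_mul (frob_self_nonneg _) (frob_self_nonneg M) (by positivity)
      (by positivity) (frob_sq_le (γ • A - 1) M) hb2) hc2
  have hJ : 0 ≤ jetSq lam r ξ M :=
    add_nonneg (add_nonneg (frob_self_nonneg M) (by positivity)) (by positivity)
  refine le_trans (le_of_eq ?_) (key.trans (mul_le_mul_of_nonneg_right hfac hJ))
  -- Up to sign, the difference of the two operators is `(γA - I) : M + γ b·ξ + (1 - γc/λ) λr`.
  rw [frob_sub_left, frob_smul_left, frob_one_left]
  field_simp
  ring

/-! ### Integrals of jets -/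

theorem integrable_sq (x : L2Y n) : Integrable (fun y => x y ^ 2) (cellMeasure n) :=
  (Lp.memLp x).integrable_sq

theorem norm_sq_eq_integral (x : L2Y n) : ‖x‖ ^ 2 = ∫ y in unitCell n, x y ^ 2 := by
  rw [← real_inner_self_eq_norm_sq, L2.inner_def]
  simp [sq]

theorem jetSq_weak (lam : ℝ) (u : L2Y n) (y : Space n) :
    jetSq lam (u y) (weakGrad u y) (weakHess u y) =
      (∑ i, ∑ j, weakPartial₂ i j u y ^ 2) + 2 * lam * (∑ i, weakPartial i u y ^ 2)
        + lam ^ 2 * u y ^ 2 := by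
  have h : ‖weakGrad u y‖ ^ 2 = ∑ i, weakPartial i u y ^ 2 := by
    simp [EuclideanSpace.real_norm_sq_eq, weakGrad]
  rw [jetSq, h]
  simp [frob, weakHess, sq]

theorem integrable_jetSq (lam : ℝ) (u : L2Y n) :
    Integrable (fun y => jetSq lam (u y) (weakGrad u y) (weakHess u y)) (cellMeasure n) := by
  simp only [jetSq_weak]
  exact ((integrable_finsetSum _ fun i _ => integrable_finsetSum _ fun j _ =>
    integrable_sq _).add ((integrable_finsetSum _ fun i _ => integrable_sq _).const_mul _)).add
      ((integrable_sq u).const_mul _)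

theorem integral_jetSq (lam : ℝ) (u : L2Y n) :
    ∫ y in unitCell n, jetSq lam (u y) (weakGrad u y) (weakHess u y) = energy lam u := by
  simp only [jetSq_weak]
  have i2 : Integrable (fun y => ∑ i, ∑ j, weakPartial₂ i j u y ^ 2) (cellMeasure n) :=
    integrable_finsetSum _ fun i _ => integrable_finsetSum _ fun j _ => integrable_sq _
  have i1 : Integrable (fun y => 2 * lam * ∑ i, weakPartial i u y ^ 2) (cellMeasure n) :=
    (integrable_finsetSum _ fun i _ => integrable_sq _).const_mul _
  erw [integral_add (i2.add i1) ((integrable_sq u).const_mul _), integral_add i2 i1]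
  rw [integral_const_mul, integral_const_mul, integral_finsetSum _ fun i _ => integrable_sq _,
    integral_finsetSum _ fun i _ => integrable_finsetSum _ fun j _ => integrable_sq _]
  simp only [integral_finsetSum _ fun _ _ => integrable_sq _, energy, norm_sq_eq_integral]

theorem coeFn_resolventOp (lam : ℝ) (u : L2Y n) :
    ∀ᵐ y ∂(cellMeasure n), resolventOp lam u y = lam * u y - (weakHess u y).trace := by
  filter_upwards [Lp.coeFn_sub (lam • u) (∑ i, weakPartial₂ i i u), Lp.coeFn_smul lam u,
    Lp.coeFn_finsetSum Finset.univ fun i => weakPartial₂ i i u] with y h1 h2 h3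
  rw [resolventOp, h1, Pi.sub_apply, h2, h3]
  simp [Matrix.trace, weakHess]

theorem coeFn_jet_sub {u v : L2Y n} (hu : u ∈ H2 n) (hv : v ∈ H2 n) :
    ∀ᵐ y ∂(cellMeasure n), (u - v : L2Y n) y = u y - v y ∧
      weakGrad (u - v) y = weakGrad u y - weakGrad v y ∧
      weakHess (u - v) y = weakHess u y - weakHess v y := by
  have h1 := ae_all_iff.2 fun i => Lp.coeFn_sub (weakPartial i u) (weakPartial i v)
  have h2 := ae_all_iff.2 fun i => ae_all_iff.2 fun j =>
    Lp.coeFn_sub (weakPartial₂ i j u) (weakPartial₂ i j v)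
  filter_upwards [Lp.coeFn_sub u v, h1, h2] with y e0 e1 e2
  refine ⟨e0, ?_, ?_⟩
  · ext i
    change weakPartial i (u - v) y = weakPartial i u y - weakPartial i v y
    rw [weakPartial_sub hu hv, e1]
    rfl
  · ext i j
    change weakPartial₂ i j (u - v) y = weakPartial₂ i j u y - weakPartial₂ i j v y
    rw [weakPartial₂_sub hu hv, e2]
    rfl

theorem measurable_jet (u : L2Y n) : Measurable fun y : Space n =>
    ((y, u y, weakGrad u y, fun i j => weakPartial₂ i j u y) :
      Space n × ℝ × Space n × (Fin n → Fin n → ℝ)) := by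
  have hm (x : L2Y n) : Measurable (fun y => x y) := (Lp.stronglyMeasurable x).measurable
  have hgrad : Measurable (weakGrad u) :=
    (PiLp.continuous_toLp 2 fun _ : Fin n => ℝ).measurable.comp
      (measurable_pi_lambda _ fun i => hm (weakPartial i u))
  have hhess : Measurable fun y (i j : Fin n) => weakPartial₂ i j u y :=
    measurable_pi_lambda _ fun i => measurable_pi_lambda _ fun j => hm (weakPartial₂ i j u)
  exact measurable_id.prodMk ((hm u).prodMk (hgrad.prodMk hhess))

/-! ### The renormalised operator -/

section Operator

variable {𝒜 ℬ : Type*} [MetricSpace 𝒜] [MetricSpace ℬ]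
  {A : Space n × 𝒜 × ℬ → Matrix (Fin n) (Fin n) ℝ} {b : Space n × 𝒜 × ℬ → Space n}
  {c f γ : Space n × 𝒜 × ℬ → ℝ}

/-- The function `γ (-A : M - b · ξ + c r - f)` whose inf-sup defines the operator. -/
def scaledSymbol (γ : Space n × 𝒜 × ℬ → ℝ) (A : Space n × 𝒜 × ℬ → Matrix (Fin n) (Fin n) ℝ)
    (b : Space n × 𝒜 × ℬ → Space n) (c f : Space n × 𝒜 × ℬ → ℝ) (p : Space n × 𝒜 × ℬ)
    (r : ℝ) (ξ : Space n) (M : Matrix (Fin n) (Fin n) ℝ) : ℝ :=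
  γ p * (-frob (A p) M - inner ℝ (b p) ξ + c p * r - f p)

/-- The inf-sup operator as a function of the point and the `2`-jet. -/
def scaledHJBI (γ : Space n × 𝒜 × ℬ → ℝ) (A : Space n × 𝒜 × ℬ → Matrix (Fin n) (Fin n) ℝ)
    (b : Space n × 𝒜 × ℬ → Space n) (c f : Space n × 𝒜 × ℬ → ℝ)
    (y : Space n) (r : ℝ) (ξ : Space n) (M : Matrix (Fin n) (Fin n) ℝ) : ℝ :=
  ⨅ α : 𝒜, ⨆ β : ℬ, scaledSymbol γ A b c f (y, α, β) r ξ M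

/-- The renormalised operator applied to `u`. -/
def scaledOp (γ : Space n × 𝒜 × ℬ → ℝ) (A : Space n × 𝒜 × ℬ → Matrix (Fin n) (Fin n) ℝ)
    (b : Space n × 𝒜 × ℬ → Space n) (c f : Space n × 𝒜 × ℬ → ℝ) (u : L2Y n)
    (y : Space n) : ℝ :=
  scaledHJBI γ A b c f y (u y) (weakGrad u y) (weakHess u y)

theorem continuous_scaledSymbol (hγ : Continuous γ) (hA : Continuous A) (hb : Continuous b)
    (hc : Continuous c) (hf : Continuous f) :
    Continuous fun z : (Space n × ℝ × Space n × (Fin n → Fin n → ℝ)) × 𝒜 × ℬ =>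
      scaledSymbol γ A b c f (z.1.1, z.2) z.1.2.1 z.1.2.2.1 (Matrix.of z.1.2.2.2) := by
  have hAij (i j : Fin n) : Continuous fun p => A p i j := hA.matrix_elem i j
  have hp : Continuous fun z : (Space n × ℝ × Space n × (Fin n → Fin n → ℝ)) × 𝒜 × ℬ =>
    (z.1.1, z.2) := by fun_prop
  simp only [scaledSymbol, frob, Matrix.of_apply]
  refine (hγ.comp hp).mul (((Continuous.neg ?_).sub ((hb.comp hp).inner (by fun_prop))).add
    ((hc.comp hp).mul (by fun_prop)) |>.sub (hf.comp hp))
  exact continuous_finsetSum _ fun i _ => continuous_finsetSum _ fun j _ =>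
    ((hAij i j).comp hp).mul (by fun_prop)

variable [CompactSpace 𝒜] [CompactSpace ℬ]

theorem continuous_scaledHJBI (hγ : Continuous γ) (hA : Continuous A) (hb : Continuous b)
    (hc : Continuous c) (hf : Continuous f) :
    Continuous fun x : Space n × ℝ × Space n × (Fin n → Fin n → ℝ) =>
      scaledHJBI γ A b c f x.1 x.2.1 x.2.2.1 (Matrix.of x.2.2.2) :=
  continuous_iInf_iSup (continuous_scaledSymbol hγ hA hb hc hf)

theorem measurable_scaledOp (hγ : Continuous γ) (hA : Continuous A) (hb : Continuous b)
    (hc : Continuous c) (hf : Continuous f) (u : L2Y n) : Measurable (scaledOp γ A b c f u) := by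
  have h : Measurable fun x : Space n × ℝ × Space n × (Fin n → Fin n → ℝ) =>
      scaledHJBI γ A b c f x.1 x.2.1 x.2.2.1 (Matrix.of x.2.2.2) :=
    (continuous_scaledHJBI hγ hA hb hc hf).measurable
  have h2 := h.comp (measurable_jet u)
  exact h2

/-- The linear part of the operator is close to `lam - Δ`, uniformly in the coefficients. -/
def NearResolvent (κ lam : ℝ) (γ : Space n × 𝒜 × ℬ → ℝ)
    (A : Space n × 𝒜 × ℬ → Matrix (Fin n) (Fin n) ℝ)
    (b : Space n × 𝒜 × ℬ → Space n) (c : Space n × 𝒜 × ℬ → ℝ) : Prop :=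
  ∀ p r ξ M, (γ p * (-frob (A p) M - inner ℝ (b p) ξ + c p * r) - (lam * r - M.trace)) ^ 2
    ≤ κ * jetSq lam r ξ M

variable {κ lam : ℝ} [Nonempty 𝒜] [Nonempty ℬ]

/-- For fixed parameters the symbol is affine in the jet, so `f` cancels in the difference and
`NearResolvent` applies to the difference of jets; the bound is uniform and survives the inf-sup. -/
theorem scaledHJBI_sub_sq_le (hγ : Continuous γ) (hA : Continuous A) (hb : Continuous b)
    (hc : Continuous c) (hf : Continuous f) (h : NearResolvent κ lam γ A b c)
    (y : Space n) (r r' : ℝ) (ξ ξ' : Space n) (M M' : Matrix (Fin n) (Fin n) ℝ) :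
    (scaledHJBI γ A b c f y r ξ M - scaledHJBI γ A b c f y r' ξ' M'
      - (lam * (r - r') - (M - M').trace)) ^ 2 ≤ κ * jetSq lam (r - r') (ξ - ξ') (M - M') := by
  have hcont (r : ℝ) (ξ : Space n) (M : Matrix (Fin n) (Fin n) ℝ) :
      Continuous fun z : 𝒜 × ℬ => scaledSymbol γ A b c f (y, z) r ξ M :=
    (continuous_scaledSymbol hγ hA hb hc hf).comp
      (by fun_prop : Continuous fun z : 𝒜 × ℬ => ((y, r, ξ, (fun i j => M i j)), z))
  obtain ⟨z₀⟩ : Nonempty (𝒜 × ℬ) := inferInstance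
  -- No sign of `κ` is assumed; the bound at a single parameter supplies it.
  have h0 : 0 ≤ κ * jetSq lam (r - r') (ξ - ξ') (M - M') :=
    (sq_nonneg _).trans (h (y, z₀) (r - r') (ξ - ξ') (M - M'))
  have key := abs_iInf_iSup_sub_sub_le (hcont r ξ M) (hcont r' ξ' M')
    (d := lam * (r - r') - (M - M').trace)
    (k := Real.sqrt (κ * jetSq lam (r - r') (ξ - ξ') (M - M'))) fun z => by
      refine Real.abs_le_sqrt ((le_of_eq ?_).trans (h (y, z) (r - r') (ξ - ξ') (M - M')))
      simp only [scaledSymbol, frob_sub_right, inner_sub_right]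
      ring
  rw [← Real.sqrt_le_sqrt_iff h0, Real.sqrt_sq_eq_abs]
  exact key

theorem scaledOp_sub_sq_le (hγ : Continuous γ) (hA : Continuous A) (hb : Continuous b)
    (hc : Continuous c) (hf : Continuous f) (h : NearResolvent κ lam γ A b c)
    {u v : L2Y n} (hu : u ∈ H2 n) (hv : v ∈ H2 n) :
    ∀ᵐ y ∂(cellMeasure n), (scaledOp γ A b c f u y - scaledOp γ A b c f v y
      - resolventOp lam (u - v) y) ^ 2 ≤
        κ * jetSq lam ((u - v : L2Y n) y) (weakGrad (u - v) y) (weakHess (u - v) y) := by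
  filter_upwards [coeFn_resolventOp lam (u - v), coeFn_jet_sub hu hv] with y h1 ⟨h2, h3, h4⟩
  rw [h1, h2, h3, h4]
  exact scaledHJBI_sub_sq_le hγ hA hb hc hf h y _ _ _ _ _ _

theorem scaledOp_sub_zero_sq_le (hγ : Continuous γ) (hA : Continuous A) (hb : Continuous b)
    (hc : Continuous c) (hf : Continuous f) (h : NearResolvent κ lam γ A b c) (u : L2Y n) :
    ∀ᵐ y ∂(cellMeasure n), (scaledOp γ A b c f u y - scaledHJBI γ A b c f y 0 0 0
      - resolventOp lam u y) ^ 2 ≤ κ * jetSq lam (u y) (weakGrad u y) (weakHess u y) := by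
  filter_upwards [coeFn_resolventOp lam u] with y h1
  have h2 := scaledHJBI_sub_sq_le hγ hA hb hc hf h y (u y) 0 (weakGrad u y) 0 (weakHess u y) 0
  rw [sub_zero, sub_zero, sub_zero] at h2
  rw [h1]
  exact h2

/-- Comparison with the zero jet, where the operator is continuous in `y` and so bounded on the
cell. It holds for every `u` in `L²(Y)`, since `weakPartial` always takes values in `L²(Y)`. -/
theorem memLp_scaledOp (hγ : Continuous γ) (hA : Continuous A) (hb : Continuous b)
    (hc : Continuous c) (hf : Continuous f) (h : NearResolvent κ lam γ A b c) (u : L2Y n) :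
    MemLp (scaledOp γ A b c f u) 2 (cellMeasure n) := by
  have hm := measurable_scaledOp hγ hA hb hc hf u
  have hc0 : Continuous fun y => scaledHJBI γ A b c f y 0 0 0 := by
    have hc1 := (continuous_scaledHJBI hγ hA hb hc hf).comp
      (by fun_prop : Continuous fun y : Space n => (y, (0 : ℝ), (0 : Space n), (0 : Fin n → Fin n → ℝ)))
    exact hc1
  have hd : AEStronglyMeasurable (fun y => scaledOp γ A b c f u y - scaledHJBI γ A b c f y 0 0 0
      - resolventOp lam u y) (cellMeasure n) :=
    (hm.aestronglyMeasurable.sub hc0.aestronglyMeasurable).sub (Lp.aestronglyMeasurable _)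
  have hdiff : MemLp (fun y => scaledOp γ A b c f u y - scaledHJBI γ A b c f y 0 0 0
      - resolventOp lam u y) 2 (cellMeasure n) := by
    rw [memLp_two_iff_integrable_sq hd]
    refine ((integrable_jetSq lam u).const_mul κ).mono' (hd.pow 2) ?_
    filter_upwards [scaledOp_sub_zero_sq_le hγ hA hb hc hf h u] with y h1
    rwa [Real.norm_of_nonneg (sq_nonneg _)]
  have hsum := (hdiff.add (Lp.memLp (resolventOp lam u))).add (memLp_of_continuous hc0)
  convert hsum using 1
  ext y
  simp only [Pi.add_apply, sub_add_cancel]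

/-- The renormalised operator with values in `L²(Y)`. -/
def scaledOpL2 (γ : Space n × 𝒜 × ℬ → ℝ) (A : Space n × 𝒜 × ℬ → Matrix (Fin n) (Fin n) ℝ)
    (b : Space n × 𝒜 × ℬ → Space n) (c f : Space n × 𝒜 × ℬ → ℝ)
    (h : ∀ u, MemLp (scaledOp γ A b c f u) 2 (cellMeasure n)) (u : L2Y n) : L2Y n :=
  (h u).toLp _

/-- The pointwise jet bound integrates to the energy of `u - v`, which the energy identity turns
into `‖(λ - Δ)(u - v)‖²`. -/
theorem norm_scaledOpL2_sub_le (hγ : Continuous γ) (hA : Continuous A) (hb : Continuous b)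
    (hc : Continuous c) (hf : Continuous f) (h : NearResolvent κ lam γ A b c)
    {u v : L2Y n} (hu : u ∈ H2per n) (hv : v ∈ H2per n) :
    ‖scaledOpL2 γ A b c f (memLp_scaledOp hγ hA hb hc hf h) u
        - scaledOpL2 γ A b c f (memLp_scaledOp hγ hA hb hc hf h) v - resolventOp lam (u - v)‖ ^ 2
      ≤ κ * ‖resolventOp lam (u - v)‖ ^ 2 := by
  have hL := memLp_scaledOp hγ hA hb hc hf h
  rw [energy_identity lam (sub_mem_H2per hu hv), ← integral_jetSq, ← integral_const_mul,
    norm_sq_eq_integral]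
  refine integral_mono_ae (integrable_sq _) ((integrable_jetSq lam _).const_mul κ) ?_
  filter_upwards [scaledOp_sub_sq_le hγ hA hb hc hf h hu.1 hv.1,
    (hL u).coeFn_toLp, (hL v).coeFn_toLp,
    Lp.coeFn_sub (scaledOpL2 γ A b c f hL u - scaledOpL2 γ A b c f hL v) (resolventOp lam (u - v)),
    Lp.coeFn_sub (scaledOpL2 γ A b c f hL u) (scaledOpL2 γ A b c f hL v)] with y h1 h2 h3 h4 h5
  rw [h4, Pi.sub_apply, h5, Pi.sub_apply, scaledOpL2, scaledOpL2, h2, h3]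
  exact h1

theorem eq_zero_of_resolventOp_eq_zero (hlam : 0 < lam) {w : L2Y n} (hw : w ∈ H2per n)
    (h : resolventOp lam w = 0) : w = 0 := by
  have h1 := energy_identity lam hw
  rw [h, norm_zero, energy] at h1
  have n1 : 0 ≤ 2 * lam * ∑ i, ‖weakPartial i w‖ ^ 2 :=
    mul_nonneg (by positivity) (Finset.sum_nonneg fun _ _ => sq_nonneg _)
  have n2 : 0 ≤ ∑ i, ∑ j, ‖weakPartial₂ i j w‖ ^ 2 :=
    Finset.sum_nonneg fun _ _ => Finset.sum_nonneg fun _ _ => sq_nonneg _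
  have n3 : 0 ≤ lam ^ 2 * ‖w‖ ^ 2 := by positivity
  have h2 : lam ^ 2 * ‖w‖ ^ 2 = 0 := by linarith
  simpa [hlam.ne'] using h2

/-- Existence and uniqueness of a zero of the renormalised operator. -/
theorem existsUnique_scaledOpL2_eq_zero (hγ : Continuous γ) (hA : Continuous A)
    (hb : Continuous b) (hc : Continuous c) (hf : Continuous f) (hlam : 0 < lam)
    (hκ0 : 0 ≤ κ) (hκ1 : κ < 1) (h : NearResolvent κ lam γ A b c) :
    ∃! u : L2Y n, u ∈ H2per n ∧
      scaledOpL2 γ A b c f (memLp_scaledOp hγ hA hb hc hf h) u = 0 := by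
  set Φ := scaledOpL2 γ A b c f (memLp_scaledOp hγ hA hb hc hf h) with hΦ
  have hnear {u v : L2Y n} (hu : u ∈ H2per n) (hv : v ∈ H2per n) :
      ‖Φ u - Φ v - resolventOp lam (u - v)‖ ≤ Real.sqrt κ * ‖resolventOp lam (u - v)‖ := by
    have := Real.sqrt_le_sqrt (norm_scaledOpL2_sub_le hγ hA hb hc hf h hu hv)
    rwa [Real.sqrt_sq (norm_nonneg _), Real.sqrt_mul hκ0, Real.sqrt_sq (norm_nonneg _)] at this
  have hsqrt : Real.sqrt κ < 1 := by rwa [Real.sqrt_lt' one_pos, one_pow]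
  choose S hS hLS using exists_resolventOp_eq (n := n) hlam
  -- `S` is a right inverse of `λ - Δ`, so in the variable `g = (λ - Δ)u` the nearness bound `hnear`
  -- is a Lipschitz bound with constant `√κ`.
  have hT : ContractingWith ⟨Real.sqrt κ, Real.sqrt_nonneg κ⟩ fun g => g - Φ (S g) := by
    refine ⟨hsqrt, LipschitzWith.of_dist_le_mul fun g g' => ?_⟩
    have h1 := hnear (hS g) (hS g')
    rw [resolventOp_sub lam (hS g).1 (hS g').1, hLS, hLS] at h1
    rw [dist_eq_norm, dist_eq_norm, ← norm_neg]
    refine le_of_eq_of_le (congrArg norm ?_) h1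
    abel
  have hfix := hT.fixedPoint_isFixedPt
  set g := ContractingWith.fixedPoint _ hT
  refine ⟨S g, ⟨hS g, by simpa [Function.IsFixedPt] using hfix⟩, ?_⟩
  rintro v ⟨hv, hv0⟩
  have hS0 : Φ (S g) = 0 := by simpa [Function.IsFixedPt] using hfix
  have h1 := hnear hv (hS g)
  rw [hv0, hS0, sub_zero, zero_sub, norm_neg] at h1
  -- For two zeros of `Φ`, `hnear` reads `‖(λ - Δ)(v - S g)‖ ≤ √κ ‖(λ - Δ)(v - S g)‖` with `√κ < 1`.
  have h2 : ‖resolventOp lam (v - S g)‖ = 0 := by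
    have := norm_nonneg (resolventOp lam (v - S g))
    by_contra hne
    have hp := lt_of_le_of_ne this (Ne.symm hne)
    exact absurd (mul_lt_mul_of_pos_right hsqrt hp) (by rw [one_mul]; exact h1.not_gt)
  exact sub_eq_zero.1 (eq_zero_of_resolventOp_eq_zero hlam (sub_mem_H2per hv (hS g))
    (norm_eq_zero.1 h2))

theorem scaledOpL2_eq_zero_iff (hγ : Continuous γ) (hA : Continuous A)
    (hb : Continuous b) (hc : Continuous c) (hf : Continuous f) (hpos : ∀ p, 0 < γ p)
    (hL : ∀ u, MemLp (scaledOp γ A b c f u) 2 (cellMeasure n)) (u : L2Y n) :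
    scaledOpL2 γ A b c f hL u = 0 ↔ ∀ᵐ y ∂(cellMeasure n), hjbiOp A b c f u y = 0 := by
  rw [Lp.eq_zero_iff_ae_eq_zero]
  have hpt (y : Space n) : scaledOp γ A b c f u y = 0 ↔ hjbiOp A b c f u y = 0 := by
    have h1 := (continuous_scaledSymbol (γ := fun _ => 1) continuous_const hA hb hc hf).comp
      (by fun_prop : Continuous fun z : 𝒜 × ℬ =>
        ((y, u y, weakGrad u y, (fun i j => weakHess u y i j)), z))
    simp only [Function.comp_def, scaledSymbol, one_mul] at h1
    exact iInf_iSup_mul_eq_zero_iff h1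
      (hγ.comp (by fun_prop : Continuous fun z : 𝒜 × ℬ => (y, z))) fun z => hpos _
  constructor
  · intro h
    filter_upwards [h, (hL u).coeFn_toLp] with y h1 h2
    rw [scaledOpL2, h2] at h1
    exact (hpt y).1 h1
  · intro h
    filter_upwards [h, (hL u).coeFn_toLp] with y h1 h2
    rw [scaledOpL2, h2]
    exact (hpt y).2 h1

end Operator

/-! ### Positivity of the renormalisation factor and conclusion -/

theorem UniformlyElliptic.trace_pos {𝒜 ℬ : Type*} {A : Space n × 𝒜 × ℬ → Matrix (Fin n) (Fin n) ℝ}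
    (hn : n ≠ 0) (hA : UniformlyElliptic A) (p : Space n × 𝒜 × ℬ) : 0 < (A p).trace := by
  obtain ⟨ζ₁, ζ₂, h1, -, h⟩ := hA
  have : Nonempty (Fin n) := Fin.pos_iff_nonempty.1 (Nat.pos_of_ne_zero hn)
  refine Finset.sum_pos (fun i _ => h1.trans_le ?_) Finset.univ_nonempty
  simpa [basisVec] using (h p (basisVec i)).1

end HJBI

end

theorem theorem2p2 {n : ℕ} (hn : 2 ≤ n)
    {𝒜 ℬ : Type*} [MetricSpace 𝒜] [CompactSpace 𝒜] [Nonempty 𝒜]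
    [MetricSpace ℬ] [CompactSpace ℬ] [Nonempty ℬ]
    (A : HJBI.Space n × 𝒜 × ℬ → Matrix (Fin n) (Fin n) ℝ)
    (b : HJBI.Space n × 𝒜 × ℬ → HJBI.Space n)
    (c f : HJBI.Space n × 𝒜 × ℬ → ℝ)
    (hA_symm : ∀ p, (A p).IsSymm)
    (hA_cont : UniformContinuous A) (hb_cont : UniformContinuous b)
    (hc_cont : UniformContinuous c) (hf_cont : UniformContinuous f)
    (hA_per : ∀ (α : 𝒜) (β : ℬ), HJBI.YPeriodic fun y => A (y, α, β))
    (hb_per : ∀ (α : 𝒜) (β : ℬ), HJBI.YPeriodic fun y => b (y, α, β))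
    (hc_per : ∀ (α : 𝒜) (β : ℬ), HJBI.YPeriodic fun y => c (y, α, β))
    (hf_per : ∀ (α : 𝒜) (β : ℬ), HJBI.YPeriodic fun y => f (y, α, β))
    (hc_pos : 0 < ⨅ p, c p)
    (hA_ell : HJBI.UniformlyElliptic A)
    (h_cordes : HJBI.CordesCondition A b c) :
    ∃! u : HJBI.L2Y n, HJBI.IsPeriodicStrongSolution A b c f u := by
  obtain ⟨δ, lam, hδ0, hδ1, hlam, hcor⟩ := h_cordes
  have hA := hA_cont.continuous
  have hb := hb_cont.continuous
  have hc := hc_cont.continuous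
  have hf := hf_cont.continuous
  -- The real infimum of a family unbounded below is `0` by convention, so a positive infimum forces
  -- boundedness.
  have hbdd : BddBelow (range c) := by
    by_contra hb
    rw [Real.iInf_of_not_bddBelow hb] at hc_pos
    exact hc_pos.false
  have hcpos (p) : 0 < c p := hc_pos.trans_le (ciInf_le hbdd p)
  have hD (p) : 0 < HJBI.cordesDenom lam (A p) (b p) (c p) := by
    have h1 := HJBI.frob_self_nonneg (A p)
    have h2 : 0 ≤ ‖b p‖ ^ 2 / (2 * lam) := by positivity
    have h3 : 0 < c p ^ 2 / lam ^ 2 := div_pos (pow_pos (hcpos p) 2) (pow_pos hlam 2)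
    exact add_pos_of_nonneg_of_pos (add_nonneg h1 h2) h3
  have hγpos (p) : 0 < HJBI.cordesScale lam (A p) (b p) (c p) :=
    div_pos (add_pos (hA_ell.trace_pos (by omega) p) (div_pos (hcpos p) hlam)) (hD p)
  have hAij (i j : Fin n) : Continuous fun p => A p i j := hA.matrix_elem i j
  have hγ : Continuous fun p => HJBI.cordesScale lam (A p) (b p) (c p) := by
    refine (hA.matrix_trace.add (hc.div_const lam)).div ?_ fun p => (hD p).ne'
    refine ((continuous_finsetSum _ fun i _ => continuous_finsetSum _ fun j _ =>
      (hAij i j).mul (hAij i j)).add ((hb.norm.pow 2).div_const _)).add ((hc.pow 2).div_const _)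
  have hnear : HJBI.NearResolvent (1 - δ) lam
      (fun p => HJBI.cordesScale lam (A p) (b p) (c p)) A b c := fun p r ξ M =>
    HJBI.cordes_estimate hδ0 hlam (hD p) (hcor p) r ξ M
  have key := HJBI.existsUnique_scaledOpL2_eq_zero hγ hA hb hc hf hlam (by linarith)
    (by linarith) hnear
  simp only [HJBI.scaledOpL2_eq_zero_iff hγ hA hb hc hf hγpos] at key
  exact key
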